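/- Let $k$ be an algebraically closed field, $Q=\mathbb P^1_k\times\mathbb P^1_k$ with bigraded coordinate ring $S=k[x_0,x_1,y_0,y_1]$, $\deg x_i=(1,0)$, $\deg y_i=(0,1)$. For a zero-dimensional closed subscheme $X\subset Q$ (possibly non-reduced) with saturated ideal $I(X)\subset S$ let $M_X^{(i,j)}=\dim_k (S/I(X))_{i,j}$ for $i,j\ge 0$, $M_X^{(i,j)}=0$ if $i<0$ or $j<0$, and $\Delta M_X^{(i,j)}=M_X^{(i,j)}-M_X^{(i-1,j)}-M_X^{(i,j-1)}+M_X^{(i-1,j-1)}$. A $(1,0)$-line (resp. $(0,1)$-line) is the zero locus of a nonzero form of bidegree $(1,0)$ (resp. $(0,1)$). The number of points of $X$ on a line $L$ with equation $l$ is the degree of the scheme with ideal the saturation of $I(X)+(l)$, and $L$ is disjoint from $X$ if this number is $0$. Let $X\subset Q$ be a zero-dimensional scheme such that $a+1$ (resp. $b+1$) is the least degree $i$ (resp. $j$) with $I(X)_{i,0}\neq 0$ (resp. $I(X)_{0,j}\ne 0$), where $a,b\ge 0$. Let $C_0,\dots,C_b$ be the $(0,1)$-lines containing $X$, that is, $X\subset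 C_0+\dots+C_b$; these are listed with multiplicity, so that lines may be repeated when $X$ is non-reduced. Let $C_{b+1},\dots,C_n$, $n\ge b$, be arbitrary $(0,1)$-lines and let $R$ be a $(1,0)$-line disjoint from $X$. Let $i_1,\dots,i_r\in\{0,\dots,b\}$ be pairwise distinct indices such that each $C_{i_k}$ is different from all $C_i$ with $i\in\{0,\dots,n\}$, $i\neq i_k$. Let $\mathcal P$ be the scheme-theoretic intersection of $R$ with the divisor $\sum_{0\le i\le n,\ i\ne i_1,\dots,i_r}C_i$ (if $C_0,\dots,C_n$ are pairwise distinct, this is the set of points $\{R\cap C_i\mid 0\le i\le n,\ i\neq i_1,\dots,i_r\}$), and let $W=X\cup\mathcal P$, that is, $I(W)=I(X)\cap I(\mathcal P)$. Let $q_k$ be the number of points of $X$ on $C_{i_k}$ and suppose that $q_1\le q_2\le\dots\le q_r$. Put $T=\{(q_1,n),(q_2,n-1),\dots,(q_r,n-r+1)\}$. Suppose that $r=1$, or that $\Delta M_X^{(i,n-k+2)}=0$ for all $k\in\{2,\dots,r\}$ and all $i\ge q_k$. Then for all $i,j\ge 0$ $$\Delta M_W^{(i,j)}=\begin{cases}1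 & \text{if } i=0,\ j\le n,\\ 0 & \text{if } i=0,\ j\ge n+1,\\ \Delta M_X^{(i-1,j)} & \text{if } i\ge 1 \text{ and } (i,j)\notin T,\\ \Delta M_X^{(i-1,j)}-1 & \text{if } i\ge 1\text{ and } (i,j)\in T.\end{cases}$$ -/

import Mathlib

noncomputable section

namespace BiProj

/-- The bihomogeneous coordinate ring `K[x₀, x₁, y₀, y₁]` of `ℙ¹ × ℙ¹`: the variables `x₀, x₁` are
`X (Sum.inl _)` and the variables `y₀, y₁` are `X (Sum.inr _)`. -/
abbrev S (K : Type*) [Field K] := MvPolynomial (Fin 2 ⊕ Fin 2) K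

/-- The bidegrees of the variables: `(1, 0)` for the `xᵢ` and `(0, 1)` for the `yᵢ`. -/
def bideg : Fin 2 ⊕ Fin 2 → ℕ × ℕ := Sum.elim (fun _ => (1, 0)) (fun _ => (0, 1))

variable {K : Type*} [Field K]

/-- The space of bihomogeneous forms of bidegree `(i, j)`. -/
def forms (K : Type*) [Field K] (i j : ℕ) : Submodule K (S K) :=
  MvPolynomial.weightedHomogeneousSubmodule K bideg (i, j)

/-- An ideal is bihomogeneous if it contains the bihomogeneous components of its elements. -/
def IsBihomogeneous (I : Ideal (S K)) : Prop :=
  ∀ f ∈ I, ∀ d : ℕ × ℕ, MvPolynomial.weightedHomogeneousComponent bideg d f ∈ I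

/-- The irrelevant ideal `(x₀, x₁) · (y₀, y₁)`. -/
def irr (K : Type*) [Field K] : Ideal (S K) :=
  Ideal.span {MvPolynomial.X (Sum.inl 0), MvPolynomial.X (Sum.inl 1)} *
    Ideal.span {MvPolynomial.X (Sum.inr 0), MvPolynomial.X (Sum.inr 1)}

/-- The saturation of an ideal with respect to the irrelevant ideal. -/
def sat (J : Ideal (S K)) : Ideal (S K) where
  carrier := {f | ∃ N : ℕ, ∀ g ∈ irr K ^ N, g * f ∈ J}
  zero_mem' := ⟨0, fun g _ => by simp⟩
  add_mem' := by
    rintro f₁ f₂ ⟨N₁, h₁⟩ ⟨N₂, h₂⟩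
    refine ⟨max N₁ N₂, fun g hg => ?_⟩
    rw [mul_add]
    exact J.add_mem (h₁ g (Ideal.pow_le_pow_right (le_max_left _ _) hg))
      (h₂ g (Ideal.pow_le_pow_right (le_max_right _ _) hg))
  smul_mem' := by
    rintro c f ⟨N, h⟩
    refine ⟨N, fun g hg => ?_⟩
    rw [smul_eq_mul, mul_left_comm]
    exact J.mul_mem_left c (h g hg)

/-- The set of closed points of `ℙ¹ × ℙ¹` at which all elements of `I` vanish (for bihomogeneous
`I` this does not depend on the chosen representatives). -/
def zeroLocus (I : Ideal (S K)) :
    Set (Projectivization K (Fin 2 → K) × Projectivization K (Fin 2 → K)) :=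
  {P | ∀ f ∈ I, MvPolynomial.eval (Sum.elim P.1.rep P.2.rep) f = 0}

/-- A zero-dimensional closed subscheme of `ℙ¹ × ℙ¹` over an algebraically closed field (possibly
non-reduced), given by its saturated bihomogeneous ideal. -/
structure ZeroDimScheme (K : Type*) [Field K] where
  ideal : Ideal (S K)
  bihomogeneous : IsBihomogeneous ideal
  saturated : sat ideal = ideal
  finite_zeroLocus : (zeroLocus ideal).Finite

/-- The Hilbert function `M(i, j) = dim_K (S / I)_{i,j}`, extended by `0` to negative indices. -/
def hilb (I : Ideal (S K)) (i j : ℤ) : ℕ :=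
  if 0 ≤ i ∧ 0 ≤ j then
    Module.finrank K
      (Submodule.map (Ideal.Quotient.mkₐ K I).toLinearMap (forms K i.toNat j.toNat))
  else 0

/-- The first difference `ΔM` of the Hilbert function. -/
def deltaHilb (I : Ideal (S K)) (i j : ℤ) : ℤ :=
  (hilb I i j : ℤ) - hilb I (i - 1) j - hilb I i (j - 1) + hilb I (i - 1) (j - 1)

/-- The first difference of the Hilbert function is of size `(a, b)`: `a + 1` and `b + 1` are
the least degrees of nonzero forms of bidegree `(*, 0)` and `(0, *)` in the ideal. -/
def HasSize (I : Ideal (S K)) (a b : ℕ) : Prop :=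
  IsLeast {i : ℕ | ∃ f ∈ I, f ∈ forms K i 0 ∧ f ≠ 0} (a + 1) ∧
    IsLeast {j : ℕ | ∃ f ∈ I, f ∈ forms K 0 j ∧ f ≠ 0} (b + 1)

/-- `d` is the degree of the zero-dimensional scheme with ideal `I`. -/
def HasDegree (I : Ideal (S K)) (d : ℕ) : Prop :=
  ∃ N : ℤ, ∀ i j : ℤ, N ≤ i → N ≤ j → hilb I i j = d

/-- The saturated ideal of the scheme-theoretic intersection of two subschemes. -/
def interIdeal (I J : Ideal (S K)) : Ideal (S K) := sat (I ⊔ J)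

/-- `d` is the number of points on the curve `l = 0` of the scheme with ideal `I`: the degree of
the scheme-theoretic intersection. -/
def NumPointsOn (I : Ideal (S K)) (l : S K) (d : ℕ) : Prop :=
  HasDegree (interIdeal I (Ideal.span {l})) d

/-- `l` is an equation of a `(1, 0)`-line. -/
def IsLine10 (l : S K) : Prop := l ∈ forms K 1 0 ∧ l ≠ 0

/-- `l` is an equation of a `(0, 1)`-line. -/
def IsLine01 (l : S K) : Prop := l ∈ forms K 0 1 ∧ l ≠ 0

/-- Two forms define the same curve. -/
def SameCurve (l m : S K) : Prop := Ideal.span {l} = Ideal.span {m}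

open scoped Classical in
/-- The ideal of the scheme cut out on the line `ρ = 0` by the curve `∏ C i = 0`, where the product
is over `i ∈ {0, …, n}` with `i ∉ E`. If the lines `C i = 0` are pairwise distinct, this is the
ideal of the finite set of points where they meet the line `ρ = 0`. -/
def pointsIdeal (ρ : S K) (C : ℕ → S K) (n : ℕ) (E : Set ℕ) : Ideal (S K) :=
  interIdeal (Ideal.span {ρ})
    (Ideal.span {∏ i ∈ (Finset.range (n + 1)).filter (fun i => i ∉ E), C i})

end BiProj

end

noncomputable section

namespace BiProj

open MvPolynomial Module

variable {K : Type*} [Field K]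

/-! Everything is computed by restriction to the line `R : ρ = 0`. Since `ρ` lies in the ideal of
`𝒫` and is a nonzerodivisor modulo `I = I(X)`, the residual ideal `I(W) : ρ` is `I`. Hence `M_W(i,j)
= M_X(i-1,j) + (j+1) - dim V`, where `V` is the restriction of `I(W)_{i,j}` to `R ≅ ℙ¹`
(`LineRetraction.hilb_eq`).

The point is that `V` consists of the degree-`j` multiples of one form: the product of the `C_m`, `m
≤ n`, omitting those `C_{i_k}` with `q_k ≤ i`. The equation of `𝒫` divides every element of `V`. If
`q_k > i`, then `C_{i_k}` divides it too, because a form of x-degree `i` cannot vanish at `q_k > i`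
points of `C_{i_k}` without vanishing on that line (`dvd_of_mem_image`).

Conversely, that product is the restriction of a form of `I` (`prodExcept_mem_image`). For one
omitted line, multiply the remaining lines by a form of bidegree `(q_k,0)` through `X ∩ C_{i_k}`
that is a nonzero constant on `R`. For several, induct on their number: restoring either of two
omitted lines gives restrictions of `I`, and two distinct lines span the linear forms in `y`, so
`y₀` and `y₁` both multiply the product into the restriction of `I`. The vanishing of `ΔM_X` says
that this restriction grows by exactly one dimension in that degree, which forces the product itself
to lie in it (`mem_image_of_X_mul_mem`).

So `M_W(i,j) = M_X(i-1,j) + min(j+1, n+1-N(i))` with `N(i) = #{k | q_k ≤ i}`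
(`hilb_inf_pointsIdeal`), and the theorem follows by taking differences. -/

/-! ### Bihomogeneous forms and the exchange of the two factors -/

theorem weight_bideg (d : Fin 2 ⊕ Fin 2 →₀ ℕ) :
    Finsupp.weight bideg d =
      (d (Sum.inl 0) + d (Sum.inl 1), d (Sum.inr 0) + d (Sum.inr 1)) := by
  rw [Finsupp.weight_apply, Finsupp.sum_fintype _ _ (by simp)]
  simp only [Fintype.sum_sum_type, Fin.sum_univ_two, bideg, Sum.elim_inl, Sum.elim_inr]
  ext <;> simp

theorem mul_mem_forms {p q : S K} {i j k l : ℕ} (hp : p ∈ forms K i j) (hq : q ∈ forms K k l) :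
    p * q ∈ forms K (i + k) (j + l) :=
  IsWeightedHomogeneous.mul (m := (i, j)) (n := (k, l)) hp hq

theorem pow_mem_forms {p : S K} {i j : ℕ} (hp : p ∈ forms K i j) (n : ℕ) :
    p ^ n ∈ forms K (n * i) (n * j) :=
  IsWeightedHomogeneous.pow (m := (i, j)) hp n

theorem one_mem_forms : (1 : S K) ∈ forms K 0 0 :=
  isWeightedHomogeneous_one K bideg

theorem C_mul_mem_forms (a : K) {p : S K} {i j : ℕ} (hp : p ∈ forms K i j) :
    C a * p ∈ forms K i j := by
  rw [← smul_eq_C_mul]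
  exact Submodule.smul_mem _ _ hp

theorem X_inl_mem_forms (e : Fin 2) : (X (Sum.inl e) : S K) ∈ forms K 1 0 :=
  isWeightedHomogeneous_X K bideg (Sum.inl e)

theorem X_inr_mem_forms (e : Fin 2) : (X (Sum.inr e) : S K) ∈ forms K 0 1 :=
  isWeightedHomogeneous_X K bideg (Sum.inr e)

theorem mul_cancel_mem_forms {p u : S K} {i j k l : ℕ} (hp : p ∈ forms K i j) (hp0 : p ≠ 0)
    (h : p * u ∈ forms K (i + k) (j + l)) : u ∈ forms K k l := by
  classical
  let := weightedGradedAlgebra K bideg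
  have h1 := DirectSum.coe_decompose_mul_add_of_left_mem
    (weightedHomogeneousSubmodule K bideg) (i := (i, j)) (j := (k, l)) (b := u) hp
  rw [DirectSum.decompose_of_mem_same (weightedHomogeneousSubmodule K bideg)
    (i := (i, j) + (k, l)) h] at h1
  rw [mul_left_cancel₀ hp0 h1]
  exact SetLike.coe_mem _

theorem eq_zero_of_dvd_of_lt {p g : S K} {d j i : ℕ} (hp : p ∈ forms K 0 d)
    (hg : g ∈ forms K i j) (hlt : j < d) (h : p ∣ g) : g = 0 := by
  classical
  obtain ⟨u, rfl⟩ := h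
  let := weightedGradedAlgebra K bideg
  have h1 := DirectSum.coe_decompose_mul_of_left_mem_of_not_le
    (weightedHomogeneousSubmodule K bideg) (i := (0, d)) (n := (i, j)) (b := u) hp
    (fun h => absurd h.2 (by simpa using hlt))
  rwa [DirectSum.decompose_of_mem_same (weightedHomogeneousSubmodule K bideg)
    (i := (i, j)) hg] at h1

theorem exists_C_of_mem_forms_zero {p : S K} (hp : p ∈ forms K 0 0) : ∃ a : K, p = C a := by
  induction hp using IsWeightedHomogeneous.induction_on with
  | zero => exact ⟨0, by simp⟩
  | add p q hp hq h1 h2 =>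
    obtain ⟨a, rfl⟩ := h1
    obtain ⟨b, rfl⟩ := h2
    exact ⟨a + b, by simp⟩
  | monomial d r hr =>
    rw [weight_bideg] at hr
    simp only [Prod.mk.injEq, Nat.add_eq_zero_iff] at hr
    refine ⟨r, ?_⟩
    have : d = 0 := by
      ext v
      rcases v with v | v <;> fin_cases v <;> simp [hr]
    rw [this]
    rfl

theorem exists_eq_X_inl_add {p : S K} {i j : ℕ} (hp : p ∈ forms K (i + 1) j) :
    ∃ u ∈ forms K i j, ∃ v ∈ forms K i j, p = X (Sum.inl 0) * u + X (Sum.inl 1) * v := by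
  induction hp using IsWeightedHomogeneous.induction_on with
  | zero => exact ⟨0, zero_mem _, 0, zero_mem _, by simp⟩
  | add p q hp hq h1 h2 =>
    obtain ⟨u, hu, v, hv, rfl⟩ := h1
    obtain ⟨u', hu', v', hv', rfl⟩ := h2
    exact ⟨u + u', add_mem hu hu', v + v', add_mem hv hv', by ring⟩
  | monomial d r hr =>
    have key : ∀ e : Fin 2, d (Sum.inl e) ≠ 0 →
        ∃ u ∈ forms K i j, monomial d r = X (Sum.inl e) * u := by
      intro e he
      have hd : d = Finsupp.single (Sum.inl e) 1 + (d - Finsupp.single (Sum.inl e) 1) := by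
        rw [add_tsub_cancel_of_le]
        simpa [Nat.one_le_iff_ne_zero] using he
      have hm : (monomial d r : S K) =
          X (Sum.inl e) * monomial (d - Finsupp.single (Sum.inl e) 1) r := by
        rw [X, monomial_mul, ← hd, one_mul]
      refine ⟨_, ?_, hm⟩
      refine mul_cancel_mem_forms (X_inl_mem_forms e) (X_ne_zero _) ?_
      rw [← hm]
      have := isWeightedHomogeneous_monomial bideg d r hr
      rw [add_comm 1 i, zero_add]
      exact this
    rw [weight_bideg] at hr
    simp only [Prod.mk.injEq] at hr
    by_cases h0 : d (Sum.inl 0) = 0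
    · obtain ⟨u, hu, h⟩ := key 1 (by omega)
      exact ⟨0, zero_mem _, u, hu, by simp [h]⟩
    · obtain ⟨u, hu, h⟩ := key 0 h0
      exact ⟨u, hu, 0, zero_mem _, by simp [h]⟩

/-- The automorphism of the coordinate ring that exchanges the two factors. -/
def swap : S K ≃ₐ[K] S K := renameEquiv K (Equiv.sumComm (Fin 2) (Fin 2))

@[simp] theorem swap_X_inl (e : Fin 2) : swap (X (Sum.inl e) : S K) = X (Sum.inr e) := by
  simp [swap]

@[simp] theorem swap_X_inr (e : Fin 2) : swap (X (Sum.inr e) : S K) = X (Sum.inl e) := by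
  simp [swap]

@[simp] theorem swap_C (a : K) : swap (C a : S K) = C a := by
  simp [swap]

@[simp] theorem swap_swap (p : S K) : swap (swap p) = p := by
  have : ((swap (K := K)).toAlgHom.comp (swap (K := K)).toAlgHom) = AlgHom.id K _ := by
    apply MvPolynomial.algHom_ext
    rintro (v | v) <;> simp
  exact DFunLike.congr_fun this p

theorem swap_mem_forms {p : S K} {i j : ℕ} (hp : p ∈ forms K i j) : swap p ∈ forms K j i := by
  induction hp using IsWeightedHomogeneous.induction_on with
  | zero => simp
  | add p q hp hq h1 h2 => rw [map_add]; exact add_mem h1 h2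
  | monomial d r hr =>
    have : swap (monomial d r : S K) =
        monomial (Finsupp.mapDomain (Equiv.sumComm (Fin 2) (Fin 2)) d) r := by
      simp [swap, rename_monomial]
    rw [this]
    refine isWeightedHomogeneous_monomial _ _ _ ?_
    have h := fun v : Fin 2 ⊕ Fin 2 => Finsupp.mapDomain_apply
      (Equiv.sumComm (Fin 2) (Fin 2)).injective d v
    have h1 := h (Sum.inl 0)
    have h2 := h (Sum.inl 1)
    have h3 := h (Sum.inr 0)
    have h4 := h (Sum.inr 1)
    simp only [Equiv.sumComm_apply, Sum.swap_inl, Sum.swap_inr] at h1 h2 h3 h4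
    rw [weight_bideg] at hr ⊢
    simp only [Equiv.sumComm_apply, h1, h2, h3, h4]
    simp only [Prod.mk.injEq] at hr ⊢
    exact hr.symm

theorem exists_eq_X_inr_add {p : S K} {i j : ℕ} (hp : p ∈ forms K i (j + 1)) :
    ∃ u ∈ forms K i j, ∃ v ∈ forms K i j, p = X (Sum.inr 0) * u + X (Sum.inr 1) * v := by
  obtain ⟨u, hu, v, hv, h⟩ := exists_eq_X_inl_add (swap_mem_forms hp)
  refine ⟨_, swap_mem_forms hu, _, swap_mem_forms hv, ?_⟩
  rw [← swap_swap p, h]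
  simp

/-! ### Equations of lines -/

theorem exists_coeff_of_isLine10 {ρ : S K} (hρ : IsLine10 ρ) :
    ∃ a b : K, ρ = C a * X (Sum.inl 0) + C b * X (Sum.inl 1) ∧ (a ≠ 0 ∨ b ≠ 0) := by
  obtain ⟨u, hu, v, hv, h⟩ := exists_eq_X_inl_add hρ.1
  obtain ⟨a, rfl⟩ := exists_C_of_mem_forms_zero hu
  obtain ⟨b, rfl⟩ := exists_C_of_mem_forms_zero hv
  refine ⟨a, b, by rw [h]; ring, ?_⟩
  by_contra! hab
  exact hρ.2 (by simp [h, hab])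

theorem IsLine01.swap {l : S K} (hl : IsLine01 l) : IsLine10 (swap l) :=
  ⟨swap_mem_forms hl.1, by simpa using hl.2⟩

theorem isLine10_X (e : Fin 2) : IsLine10 (X (Sum.inl e) : S K) :=
  ⟨X_inl_mem_forms e, X_ne_zero _⟩

theorem IsLine10.irreducible {ρ : S K} (hρ : IsLine10 ρ) : Irreducible ρ := by
  have hom : ρ.IsHomogeneous 1 := by
    obtain ⟨a, b, h, -⟩ := exists_coeff_of_isLine10 hρ
    rw [h]
    exact ((isHomogeneous_X _ _).C_mul a).add ((isHomogeneous_X _ _).C_mul b)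
  refine irreducible_of_totalDegree_eq_one (hom.totalDegree hρ.2) fun x hx => ?_
  obtain ⟨d, hd⟩ := exists_coeff_ne_zero hρ.2
  exact (ne_zero_of_dvd_ne_zero hd (hx d)).isUnit

theorem IsLine01.prime {l : S K} (hl : IsLine01 l) : Prime l := by
  have h := hl.swap.irreducible.prime
  exact (MulEquiv.prime_iff (BiProj.swap (K := K))).1 h

/-! ### Restriction to a `(1,0)`-line -/

/-- A retraction of the coordinate ring onto the forms in the `yᵢ`, which realizes the
identification of the line `ρ = 0` with `ℙ¹`. -/
structure LineRetraction (ρ : S K) where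
  /-- a form complementary to `ρ` -/
  ξ : S K
  /-- the retraction -/
  φ : S K →ₐ[K] S K
  ξ_mem : ξ ∈ forms K 1 0
  φ_ρ : φ ρ = 0
  φ_ξ : φ ξ = 1
  -- Modulo `ρ` both `x`-variables are multiples of `ξ`, and `φ` dehomogenizes by `ξ = 1`.
  φ_X_inl : ∀ e, ∃ a, φ (X (Sum.inl e)) = C a ∧ ρ ∣ X (Sum.inl e) - C a * ξ
  φ_X_inr : ∀ e, φ (X (Sum.inr e)) = X (Sum.inr e)

theorem IsLine10.exists_lineRetraction {ρ : S K} (hρ : IsLine10 ρ) :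
    Nonempty (LineRetraction ρ) := by
  obtain ⟨a, b, h, hab⟩ := exists_coeff_of_isLine10 hρ
  rcases hab with ha | hb
  · have hCa : (C a * C a⁻¹ : S K) = 1 := by rw [← C_mul, mul_inv_cancel₀ ha, C_1]
    exact ⟨{
      ξ := X (Sum.inl 1)
      φ := aeval (Sum.elim ![C (-a⁻¹ * b), 1] (fun e => X (Sum.inr e)))
      ξ_mem := X_inl_mem_forms 1
      φ_ρ := by
        simp only [h, map_add, map_mul, aeval_X, algHom_C, algebraMap_eq, Sum.elim_inl,
          Matrix.cons_val_zero, Matrix.cons_val_one, map_neg]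
        linear_combination -(C b) * hCa
      φ_ξ := by simp
      φ_X_inl := by
        intro e
        fin_cases e
        · refine ⟨-a⁻¹ * b, by simp, C a⁻¹, ?_⟩
          simp only [h, map_mul, map_neg]
          simp
          linear_combination -(X (Sum.inl 0)) * hCa
        · exact ⟨1, by simp, by simp⟩
      φ_X_inr := by simp }⟩
  · have hCb : (C b * C b⁻¹ : S K) = 1 := by rw [← C_mul, mul_inv_cancel₀ hb, C_1]
    exact ⟨{
      ξ := X (Sum.inl 0)
      φ := aeval (Sum.elim ![1, C (-b⁻¹ * a)] (fun e => X (Sum.inr e)))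
      ξ_mem := X_inl_mem_forms 0
      φ_ρ := by
        simp only [h, map_add, map_mul, aeval_X, algHom_C, algebraMap_eq, Sum.elim_inl,
          Matrix.cons_val_zero, Matrix.cons_val_one, map_neg]
        linear_combination -(C a) * hCb
      φ_ξ := by simp
      φ_X_inl := by
        intro e
        fin_cases e
        · exact ⟨1, by simp, by simp⟩
        · refine ⟨-b⁻¹ * a, by simp, C b⁻¹, ?_⟩
          simp only [h, map_mul, map_neg]
          simp
          linear_combination -(X (Sum.inl 1)) * hCb
      φ_X_inr := by simp }⟩

namespace LineRetraction

variable {ρ : S K} (R : LineRetraction ρ)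

theorem φ_C (a : K) : R.φ (C a) = C a := by
  simp [algHom_C]

theorem φ_eq_self {g : S K} {j : ℕ} (hg : g ∈ forms K 0 j) : R.φ g = g := by
  induction j generalizing g with
  | zero =>
    obtain ⟨a, rfl⟩ := exists_C_of_mem_forms_zero hg
    exact R.φ_C a
  | succ j ih =>
    obtain ⟨u, hu, v, hv, rfl⟩ := exists_eq_X_inr_add hg
    simp [ih hu, ih hv, R.φ_X_inr]

theorem φ_mem_and_dvd {v : S K} {i j : ℕ} (hv : v ∈ forms K i j) :
    R.φ v ∈ forms K 0 j ∧ ρ ∣ v - R.ξ ^ i * R.φ v := by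
  induction i generalizing v with
  | zero => simp [R.φ_eq_self hv, hv]
  | succ i ih =>
    obtain ⟨u, hu, w, hw, rfl⟩ := exists_eq_X_inl_add hv
    obtain ⟨hu1, a, ha⟩ := ih hu
    obtain ⟨hw1, b, hb⟩ := ih hw
    obtain ⟨r, hr, c, hc⟩ := R.φ_X_inl 0
    obtain ⟨s, hs, d, hd⟩ := R.φ_X_inl 1
    simp only [map_add, map_mul, hr, hs]
    refine ⟨add_mem (C_mul_mem_forms _ hu1) (C_mul_mem_forms _ hw1),
      c * u + C r * R.ξ * a + d * w + C s * R.ξ * b, ?_⟩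
    linear_combination u * hc + C r * R.ξ * ha + w * hd + C s * R.ξ * hb

theorem φ_mem {v : S K} {i j : ℕ} (hv : v ∈ forms K i j) : R.φ v ∈ forms K 0 j :=
  (R.φ_mem_and_dvd hv).1

theorem dvd_sub {v : S K} {i j : ℕ} (hv : v ∈ forms K i j) : ρ ∣ v - R.ξ ^ i * R.φ v :=
  (R.φ_mem_and_dvd hv).2

theorem φ_eq_zero_of_dvd {v : S K} (h : ρ ∣ v) : R.φ v = 0 := by
  obtain ⟨u, rfl⟩ := h
  simp [R.φ_ρ]

theorem φ_eq_zero_iff {v : S K} {i j : ℕ} (hv : v ∈ forms K i j) : R.φ v = 0 ↔ ρ ∣ v := by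
  refine ⟨fun h => ?_, R.φ_eq_zero_of_dvd⟩
  simpa [h] using R.dvd_sub hv

theorem ξ_pow_mul_mem {g : S K} {j : ℕ} (hg : g ∈ forms K 0 j) (i : ℕ) :
    R.ξ ^ i * g ∈ forms K i j := by
  simpa using mul_mem_forms (pow_mem_forms R.ξ_mem i) hg

theorem φ_ξ_pow_mul {g : S K} {j : ℕ} (hg : g ∈ forms K 0 j) (i : ℕ) :
    R.φ (R.ξ ^ i * g) = g := by
  simp [R.φ_ξ, R.φ_eq_self hg]

end LineRetraction

/-! ### Dimensions of graded pieces and the residual sequence -/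

instance finite_forms (i j : ℕ) : Module.Finite K (forms K i j) := by
  have h : forms K i j ≤ restrictTotalDegree (Fin 2 ⊕ Fin 2) K (i + j) := by
    intro p hp
    rw [mem_restrictTotalDegree, totalDegree]
    refine Finset.sup_le fun d hd => ?_
    have h1 := hp (mem_support_iff.1 hd)
    rw [weight_bideg] at h1
    simp only [Prod.mk.injEq] at h1
    rw [Finsupp.sum_fintype _ _ (by simp)]
    simp only [Fintype.sum_sum_type, Fin.sum_univ_two]
    omega
  exact Submodule.finiteDimensional_of_le h

theorem finrank_map_add_finrank_inf_ker {E F : Type*} [AddCommGroup E] [Module K E]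
    [AddCommGroup F] [Module K F] (f : E →ₗ[K] F) (p : Submodule K E) [Module.Finite K p] :
    finrank K (p.map f) + finrank K ↥(p ⊓ LinearMap.ker f) = finrank K p := by
  have h := (f.domRestrict p).finrank_range_add_finrank_ker
  rw [LinearMap.range_domRestrict, LinearMap.ker_domRestrict] at h
  rw [← h, ← Submodule.map_comap_subtype, Submodule.finrank_map_subtype_eq]

/-- The forms of bidegree `(i, j)` in an ideal. -/
def part (V : Ideal (S K)) (i j : ℕ) : Submodule K (S K) :=
  V.restrictScalars K ⊓ forms K i j

theorem mem_part {V : Ideal (S K)} {i j : ℕ} {p : S K} :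
    p ∈ part V i j ↔ p ∈ V ∧ p ∈ forms K i j := Iff.rfl

instance finite_part (V : Ideal (S K)) (i j : ℕ) : Module.Finite K (part V i j) :=
  Submodule.finiteDimensional_of_le (inf_le_right : part V i j ≤ forms K i j)

theorem part_top (i j : ℕ) : part (⊤ : Ideal (S K)) i j = forms K i j := by
  ext; simp [mem_part]

theorem hilb_add_finrank_part (V : Ideal (S K)) (i j : ℕ) :
    hilb V i j + finrank K (part V i j) = finrank K (forms K i j) := by
  have h := finrank_map_add_finrank_inf_ker (Ideal.Quotient.mkₐ K V).toLinearMap (forms K i j)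
  rw [← h, hilb, if_pos ⟨by positivity, by positivity⟩]
  simp only [Int.toNat_natCast]
  have hker : part V i j = forms K i j ⊓ LinearMap.ker (Ideal.Quotient.mkₐ K V).toLinearMap := by
    ext p
    simp [mem_part, Ideal.Quotient.eq_zero_iff_mem, and_comm]
  rw [hker]

theorem finrank_map_mul_left {p : S K} (hp : p ≠ 0) (U : Submodule K (S K)) :
    finrank K (U.map (LinearMap.mulLeft K p)) = finrank K U :=
  (LinearEquiv.finrank_eq (Submodule.equivMapOfInjective _
    (mul_right_injective₀ hp) U)).symm

namespace LineRetraction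

variable {ρ : S K} (R : LineRetraction ρ)

/-- The image in the forms of bidegree `(0, j)` of the part of bidegree `(i, j)` of an ideal. -/
def image (V : Ideal (S K)) (i j : ℕ) : Submodule K (S K) :=
  (part V i j).map R.φ.toLinearMap

theorem mem_image {V : Ideal (S K)} {i j : ℕ} {g : S K} :
    g ∈ R.image V i j ↔ ∃ v ∈ V, v ∈ forms K i j ∧ R.φ v = g := by
  simp [image, Submodule.mem_map, mem_part, and_assoc]

instance finite_image (V : Ideal (S K)) (i j : ℕ) : Module.Finite K (R.image V i j) := by
  unfold image; infer_instance

theorem image_le_forms (V : Ideal (S K)) (i j : ℕ) : R.image V i j ≤ forms K 0 j := by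
  intro g hg
  obtain ⟨v, -, hv, rfl⟩ := R.mem_image.1 hg
  exact R.φ_mem hv

theorem image_zero_left (V : Ideal (S K)) (j : ℕ) : R.image V 0 j = part V 0 j := by
  ext g
  rw [R.mem_image, mem_part]
  constructor
  · rintro ⟨v, hv, hv', rfl⟩
    rw [R.φ_eq_self hv']
    exact ⟨hv, hv'⟩
  · rintro ⟨h1, h2⟩
    exact ⟨g, h1, h2, R.φ_eq_self h2⟩

theorem image_top (i j : ℕ) : R.image ⊤ i j = forms K 0 j := by
  refine le_antisymm (R.image_le_forms _ _ _) fun g hg => ?_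
  exact R.mem_image.2 ⟨R.ξ ^ i * g, trivial, R.ξ_pow_mul_mem hg i, R.φ_ξ_pow_mul hg i⟩

theorem mul_mem_image {V : Ideal (S K)} {i j k : ℕ} {g h : S K} (hg : g ∈ R.image V i j)
    (hh : h ∈ forms K 0 k) : h * g ∈ R.image V i (k + j) := by
  obtain ⟨v, hv, hv', rfl⟩ := R.mem_image.1 hg
  refine R.mem_image.2 ⟨h * v, V.mul_mem_left _ hv, by simpa using mul_mem_forms hh hv', ?_⟩
  rw [map_mul, R.φ_eq_self hh]

theorem image_mono (V : Ideal (S K)) {i i' : ℕ} (h : i ≤ i') (j : ℕ) :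
    R.image V i j ≤ R.image V i' j := by
  intro g hg
  obtain ⟨v, hv, hv', rfl⟩ := R.mem_image.1 hg
  refine R.mem_image.2 ⟨R.ξ ^ (i' - i) * v, V.mul_mem_left _ hv, ?_, by simp [R.φ_ξ]⟩
  have := mul_mem_forms (pow_mem_forms R.ξ_mem (i' - i)) hv'
  simpa [Nat.sub_add_cancel h] using this

/-- The kernel of restriction to `ρ = 0` is the set of multiples of `ρ`; as `h` says `V : ρ = I`, in
`V` this kernel is `ρ · I_{i,j}`. -/
theorem finrank_part_succ (hρ : IsLine10 ρ) {V I : Ideal (S K)} (h : ∀ u, ρ * u ∈ V ↔ u ∈ I)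
    (i j : ℕ) : finrank K (part V (i + 1) j) =
      finrank K (R.image V (i + 1) j) + finrank K (part I i j) := by
  rw [← finrank_map_add_finrank_inf_ker R.φ.toLinearMap (part V (i + 1) j), image]
  congr 1
  rw [← finrank_map_mul_left hρ.2 (part I i j)]
  have hker : part V (i + 1) j ⊓ LinearMap.ker R.φ.toLinearMap =
      (part I i j).map (LinearMap.mulLeft K ρ) := ?_
  · rw [hker]
  ext p
  simp only [Submodule.mem_inf, LinearMap.mem_ker, AlgHom.toLinearMap_apply, Submodule.mem_map,
    LinearMap.mulLeft_apply, mem_part]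
  constructor
  · rintro ⟨⟨hp, hp'⟩, h0⟩
    obtain ⟨u, rfl⟩ := (R.φ_eq_zero_iff hp').1 h0
    refine ⟨u, ⟨(h u).1 hp, mul_cancel_mem_forms hρ.1 hρ.2 ?_⟩, rfl⟩
    rwa [add_comm 1 i, zero_add]
  · rintro ⟨u, ⟨hu, hu'⟩, rfl⟩
    refine ⟨⟨(h u).2 hu, ?_⟩, by simp [R.φ_ρ]⟩
    simpa [add_comm] using mul_mem_forms hρ.1 hu'

end LineRetraction

theorem finrank_forms_zero_zero : finrank K (forms K 0 0) = 1 := by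
  refine finrank_eq_one (⟨1, one_mem_forms⟩ : forms K 0 0) (by simp) ?_
  rintro ⟨w, hw⟩
  obtain ⟨a, rfl⟩ := exists_C_of_mem_forms_zero hw
  exact ⟨a, Subtype.ext (by simp [smul_eq_C_mul])⟩

theorem finrank_forms_succ (i j : ℕ) :
    finrank K (forms K (i + 1) j) = finrank K (forms K 0 j) + finrank K (forms K i j) := by
  obtain ⟨R⟩ := (isLine10_X (K := K) 0).exists_lineRetraction
  have h := R.finrank_part_succ (isLine10_X 0) (V := ⊤) (I := ⊤) (by simp) i j
  rwa [R.image_top, part_top, part_top] at h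

theorem finrank_forms_left (i : ℕ) : finrank K (forms K i 0) = i + 1 := by
  induction i with
  | zero => exact finrank_forms_zero_zero
  | succ i ih => rw [finrank_forms_succ, ih, finrank_forms_zero_zero]; ring

theorem finrank_forms_right (j : ℕ) : finrank K (forms K 0 j) = j + 1 := by
  rw [← finrank_forms_left (K := K) j]
  have : forms K 0 j = (forms K j 0).map (swap (K := K)).toLinearMap := by
    ext p
    simp only [Submodule.mem_map, AlgEquiv.toLinearMap_apply]
    exact ⟨fun hp => ⟨swap p, swap_mem_forms hp, by simp⟩,
      fun ⟨q, hq, h⟩ => h ▸ swap_mem_forms hq⟩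
  rw [this]
  exact (LinearEquiv.finrank_eq (Submodule.equivMapOfInjective (swap (K := K)).toLinearMap
    (swap (K := K)).injective _)).symm

theorem LineRetraction.hilb_eq {ρ : S K} (R : LineRetraction ρ) (hρ : IsLine10 ρ)
    {V I : Ideal (S K)} (h : ∀ u, ρ * u ∈ V ↔ u ∈ I) (i j : ℕ) :
    (hilb V i j : ℤ) = hilb I ((i : ℤ) - 1) j + (j + 1) - finrank K (R.image V i j) := by
  have h1 := hilb_add_finrank_part V i j
  cases i with
  | zero =>
    have h2 : hilb I (((0 : ℕ) : ℤ) - 1) j = 0 := by simp [hilb]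
    rw [h2, R.image_zero_left]
    rw [finrank_forms_right] at h1
    omega
  | succ i =>
    have h2 := hilb_add_finrank_part I i j
    have h3 := R.finrank_part_succ hρ h i j
    rw [finrank_forms_succ, finrank_forms_right] at h1
    have h4 : (((i + 1 : ℕ) : ℤ) - 1) = (i : ℤ) := by simp
    rw [h4]
    omega

theorem hilb_of_neg_left (I : Ideal (S K)) {i j : ℤ} (h : i < 0) : hilb I i j = 0 := by
  simp [hilb, h.not_ge]

theorem hilb_of_neg_right (I : Ideal (S K)) {i j : ℤ} (h : j < 0) : hilb I i j = 0 := by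
  simp [hilb, h.not_ge]

theorem finrank_part_span {p : S K} {d : ℕ} (hp : p ∈ forms K 0 d) (hp0 : p ≠ 0) (j : ℕ) :
    finrank K (part (Ideal.span {p}) 0 j) = j + 1 - d := by
  rcases lt_or_ge j d with hlt | hle
  · have : part (Ideal.span {p}) 0 j = ⊥ := by
      rw [eq_bot_iff]
      rintro g ⟨hg, hg'⟩
      exact eq_zero_of_dvd_of_lt hp hg' hlt (Ideal.mem_span_singleton.1 hg)
    rw [this, finrank_bot]
    omega
  · obtain ⟨e, rfl⟩ := Nat.exists_eq_add_of_le hle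
    have : part (Ideal.span {p}) 0 (d + e) = (forms K 0 e).map (LinearMap.mulLeft K p) := by
      ext g
      simp only [mem_part, Ideal.mem_span_singleton, Submodule.mem_map, LinearMap.mulLeft_apply]
      constructor
      · rintro ⟨⟨u, rfl⟩, hu⟩
        exact ⟨u, mul_cancel_mem_forms hp hp0 (by simpa using hu), rfl⟩
      · rintro ⟨u, hu, rfl⟩
        exact ⟨dvd_mul_right _ _, by simpa using mul_mem_forms hp hu⟩
    rw [this, finrank_map_mul_left hp0, finrank_forms_right]
    omega

/-- Multiplication by the linear forms in `y₀, y₁` increases the dimension of a nonzero space of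
forms. -/
theorem finrank_lt_of_X_mul_mem {U U' : Submodule K (S K)} [Module.Finite K U]
    [Module.Finite K U'] (hU : U ≠ ⊥)
    (h : ∀ u ∈ U, ∀ e, X (Sum.inr e) * u ∈ U') : finrank K U < finrank K U' := by
  have h0 := finrank_map_mul_left (K := K) (X_ne_zero (Sum.inr 0)) U
  rw [← h0]
  refine Submodule.finrank_lt_finrank_of_lt (lt_of_le_of_ne ?_ fun heq => hU ?_)
  · rintro _ ⟨u, hu, rfl⟩
    exact h u hu 0
  -- If `y₀U` were all of `U'`, then `y₁U ⊆ y₀U`, so each element of `U` would be divisible by every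
  -- power of the prime `y₀`.
  have hdvd : ∀ m : ℕ, ∀ u ∈ U, (X (Sum.inr 0) : S K) ^ m ∣ u := by
    intro m
    induction m with
    | zero => simp
    | succ m ih =>
      intro u hu
      have h1 := h u hu 1
      rw [← heq] at h1
      obtain ⟨u', hu', h2⟩ := h1
      rw [LinearMap.mulLeft_apply] at h2
      have h3 : (X (Sum.inr 0) : S K) ^ (m + 1) ∣ X (Sum.inr 1) * u := by
        rw [← h2, pow_succ']
        exact mul_dvd_mul_left _ (ih u' hu')
      refine X_prime.pow_dvd_of_dvd_mul_left (m + 1) ?_ h3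
      rw [X_dvd_X]
      simp
  rw [eq_bot_iff]
  intro u hu
  by_contra hu0
  obtain ⟨m, hm⟩ := FiniteMultiplicity.of_prime_left 
    (X_prime (R := K) (i := (Sum.inr 0 : Fin 2 ⊕ Fin 2))) hu0
  exact hm (hdvd _ u hu)

/-! ### Saturation and disjointness -/

theorem le_sat (J : Ideal (S K)) : J ≤ sat J :=
  fun _ hf => ⟨0, fun g _ => J.mul_mem_left g hf⟩

theorem irr_pow_le_span_forms (N : ℕ) :
    irr K ^ N ≤ Ideal.span (forms K N N : Set (S K)) := by
  induction N with
  | zero =>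
    have : (1 : S K) ∈ Ideal.span (forms K 0 0 : Set (S K)) := Ideal.subset_span one_mem_forms
    rw [(Ideal.eq_top_iff_one _).2 this]
    exact le_top
  | succ N ih =>
    have h1 : irr K ≤ Ideal.span (forms K 1 1 : Set (S K)) := by
      rw [irr, Ideal.span_mul_span', Ideal.span_le]
      rintro _ ⟨u, hu, v, hv, rfl⟩
      refine Ideal.subset_span ?_
      simp only [Set.mem_insert_iff, Set.mem_singleton_iff] at hu hv
      rcases hu with rfl | rfl <;> rcases hv with rfl | rfl <;>
        exact mul_mem_forms (X_inl_mem_forms _) (X_inr_mem_forms _)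
    rw [pow_succ]
    refine (Ideal.mul_mono ih h1).trans ?_
    rw [Ideal.span_mul_span', Ideal.span_le]
    rintro _ ⟨u, hu, v, hv, rfl⟩
    exact Ideal.subset_span (mul_mem_forms hu hv)

theorem X_mul_X_mem_irr (e e' : Fin 2) : (X (Sum.inl e) * X (Sum.inr e') : S K) ∈ irr K := by
  refine Ideal.mul_mem_mul (Ideal.subset_span ?_) (Ideal.subset_span ?_) <;>
    [fin_cases e; fin_cases e'] <;> simp

theorem sat_sat (J : Ideal (S K)) : sat (sat J) = sat J := by
  refine le_antisymm ?_ (le_sat _)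
  rintro f ⟨N, hN⟩
  obtain ⟨s, hs⟩ := IsNoetherian.noetherian (irr K ^ N)
  have h1 : ∀ g ∈ s, ∃ M : ℕ, ∀ h ∈ irr K ^ M, h * (g * f) ∈ J :=
    fun g hg => hN g (hs ▸ Submodule.subset_span hg)
  choose! M hM using h1
  refine ⟨s.sup M + N, fun h hh => ?_⟩
  rw [pow_add] at hh
  refine Submodule.mul_induction_on hh (fun a ha b hb => ?_) fun a b ha hb => ?_
  · rw [← hs] at hb
    refine Submodule.span_induction (p := fun b _ => a * b * f ∈ J) ?_ (by simp) ?_ ?_ hb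
    · intro g hg
      rw [mul_assoc]
      exact hM g hg a (Ideal.pow_le_pow_right (Finset.le_sup hg) ha)
    · intro x y _ _ hx hy
      simpa [mul_add, add_mul] using J.add_mem hx hy
    · intro c x _ hx
      have := J.mul_mem_left c hx
      rw [smul_eq_mul]
      convert this using 1
      ring
  · rw [add_mul]
    exact J.add_mem ha hb

theorem mem_of_irr_pow_mul_mem {J : Ideal (S K)} (hJ : sat J = J) {f : S K} (N : ℕ)
    (h : ∀ g ∈ irr K ^ N, g * f ∈ J) : f ∈ J :=
  hJ ▸ (⟨N, h⟩ : f ∈ sat J)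

theorem forms_le_of_hilb_eq_zero {J : Ideal (S K)} {i j : ℕ} (h : hilb J i j = 0) {f : S K}
    (hf : f ∈ forms K i j) : f ∈ J := by
  have h1 := hilb_add_finrank_part J i j
  rw [h, zero_add] at h1
  have h2 : part J i j = forms K i j := Submodule.eq_of_le_of_finrank_eq inf_le_right h1
  rw [← h2] at hf
  exact hf.1

/-- The equation of a curve disjoint from a scheme is a nonzerodivisor modulo the ideal of each
of its subschemes. -/
theorem mul_mem_iff_of_numPointsOn_zero {I J : Ideal (S K)} {ρ : S K} (h : NumPointsOn I ρ 0)
    (hIJ : I ≤ J) (hJ : sat J = J) (f : S K) : ρ * f ∈ J ↔ f ∈ J := by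
  refine ⟨fun hf => ?_, J.mul_mem_left ρ⟩
  obtain ⟨N, hN⟩ := h
  -- Degree zero makes all forms of large bidegree lie in the saturation of `I + (ρ)`, so that this
  -- ideal is irrelevant.
  have h1 : irr K ^ N.toNat ≤ sat (I ⊔ Ideal.span {ρ}) := by
    refine (irr_pow_le_span_forms _).trans (Ideal.span_le.2 fun p hp => ?_)
    exact forms_le_of_hilb_eq_zero (hN _ _ (Int.self_le_toNat N) (Int.self_le_toNat N)) hp
  refine mem_of_irr_pow_mul_mem hJ N.toNat fun g hg => ?_
  obtain ⟨M, hM⟩ := h1 hg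
  refine mem_of_irr_pow_mul_mem hJ M fun k hk => ?_
  obtain ⟨a, ha, b, hb, hab⟩ := Submodule.mem_sup.1 (hM k hk)
  obtain ⟨c, rfl⟩ := Ideal.mem_span_singleton.1 hb
  have : k * (g * f) = f * a + c * (ρ * f) := by linear_combination -f * hab
  rw [this]
  exact J.add_mem (J.mul_mem_left _ (hIJ ha)) (J.mul_mem_left _ hf)

/-- Multiplication by `p` sends `I + (l)` into `I`, and saturatedness of `I` extends this to the
saturation. -/
theorem mul_mem_of_mem_interIdeal {I : Ideal (S K)} (hI : sat I = I) {l p f : S K}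
    (hp : p * l ∈ I) (hf : f ∈ interIdeal I (Ideal.span {l})) : f * p ∈ I := by
  obtain ⟨N, hN⟩ := hf
  refine mem_of_irr_pow_mul_mem hI N fun g hg => ?_
  obtain ⟨a, ha, b, hb, hab⟩ := Submodule.mem_sup.1 (hN g hg)
  obtain ⟨c, rfl⟩ := Ideal.mem_span_singleton.1 hb
  have : g * (f * p) = p * a + c * (p * l) := by linear_combination -p * hab
  rw [this]
  exact I.add_mem (I.mul_mem_left _ ha) (I.mul_mem_left _ hp)

theorem le_interIdeal_left (I J : Ideal (S K)) : I ≤ interIdeal I J :=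
  le_sup_left.trans (le_sat _)

theorem mem_interIdeal_right (I : Ideal (S K)) (l : S K) : l ∈ interIdeal I (Ideal.span {l}) :=
  le_sat _ (Ideal.mem_sup_right (Ideal.mem_span_singleton_self l))

/-! ### Restriction to a `(0,1)`-line and its points -/

namespace LineRetraction

variable {l : S K} (R : LineRetraction (swap l))

/-- The retraction onto the forms in the `xᵢ` given by a `(0, 1)`-line. -/
def ψ : S K →ₐ[K] S K := (swap (K := K)).toAlgHom.comp (R.φ.comp (swap (K := K)).toAlgHom)

theorem ψ_apply (v : S K) : R.ψ v = swap (R.φ (swap v)) := rfl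

theorem ψ_mem {v : S K} {i j : ℕ} (hv : v ∈ forms K i j) : R.ψ v ∈ forms K i 0 :=
  swap_mem_forms (R.φ_mem (swap_mem_forms hv))

theorem dvd_sub_ψ {v : S K} {i j : ℕ} (hv : v ∈ forms K i j) :
    l ∣ v - swap R.ξ ^ j * R.ψ v := by
  have := map_dvd (swap (K := K)) (R.dvd_sub (swap_mem_forms hv))
  simpa [ψ_apply] using this

theorem ψ_comm {ρ : S K} (T : LineRetraction ρ) (v : S K) : R.ψ (T.φ v) = T.φ (R.ψ v) := by
  have : R.ψ.comp T.φ = T.φ.comp R.ψ := by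
    apply MvPolynomial.algHom_ext
    rintro (e | e)
    · obtain ⟨a, ha, -⟩ := T.φ_X_inl e
      simp [ha, ψ_apply, R.φ_X_inr]
    · obtain ⟨a, ha, -⟩ := R.φ_X_inl e
      simp [ha, ψ_apply, T.φ_X_inr]
  exact DFunLike.congr_fun this v

theorem dvd_of_ψ_eq_zero {v : S K} {i j : ℕ} (hv : v ∈ forms K i j) (h : R.ψ v = 0) :
    l ∣ v := by
  simpa [h] using R.dvd_sub_ψ hv

/-- Modulo `l` every form of bidegree `(j,j)` is a multiple of `swap R.ξ ^ j`, so `irr K ^ j` lies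
in the ideal of this power and `l`. -/
theorem mem_of_ξ_pow_mul_mem {J : Ideal (S K)} (hJ : sat J = J) (hl : l ∈ J) {f : S K} {j : ℕ} :
    swap R.ξ ^ j * f ∈ J ↔ f ∈ J := by
  refine ⟨fun hf => mem_of_irr_pow_mul_mem hJ j fun g hg => ?_, J.mul_mem_left _⟩
  have h1 : irr K ^ j ≤ Ideal.span {swap R.ξ ^ j, l} := by
    refine (irr_pow_le_span_forms j).trans (Ideal.span_le.2 fun p hp => ?_)
    obtain ⟨c, hc⟩ := R.dvd_sub_ψ hp
    exact Ideal.mem_span_pair.2 ⟨R.ψ p, c, by linear_combination -hc⟩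
  obtain ⟨a, b, rfl⟩ := Ideal.mem_span_pair.1 (h1 hg)
  have : (a * swap R.ξ ^ j + b * l) * f = a * (swap R.ξ ^ j * f) + b * f * l := by ring
  rw [this]
  exact J.add_mem (J.mul_mem_left _ hf) (J.mul_mem_left _ hl)

theorem ψ_mem_ideal {J : Ideal (S K)} (hJ : sat J = J) (hl : l ∈ J) {v : S K} {i j : ℕ}
    (hv : v ∈ forms K i j) (hvJ : v ∈ J) : R.ψ v ∈ J := by
  rw [← R.mem_of_ξ_pow_mul_mem hJ hl (j := j)]
  have := J.sub_mem hvJ (J.mem_of_dvd (R.dvd_sub_ψ hv) hl)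
  rwa [sub_sub_cancel] at this

/-- On the line `l = 0` the power `swap R.ξ ^ j` identifies the quotient in bidegrees `(m,0)` and
`(m,j)`. -/
theorem hilb_add_finrank_part_zero (R : LineRetraction (swap l))
    {J : Ideal (S K)} (hJ : sat J = J) (hlJ : l ∈ J) (m j : ℕ) : hilb J m j + finrank K (part J m 0) = m + 1 := by
  have h := finrank_map_add_finrank_inf_ker
    ((Ideal.Quotient.mkₐ K J).toLinearMap ∘ₗ LinearMap.mulLeft K (swap R.ξ ^ j)) (forms K m 0)
  rw [finrank_forms_left] at h
  have h1 : (forms K m j).map (Ideal.Quotient.mkₐ K J).toLinearMap = (forms K m 0).map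
      ((Ideal.Quotient.mkₐ K J).toLinearMap ∘ₗ LinearMap.mulLeft K (swap R.ξ ^ j)) := by
    apply le_antisymm
    · rintro _ ⟨v, hv, rfl⟩
      refine ⟨R.ψ v, R.ψ_mem hv, ?_⟩
      simp only [LinearMap.comp_apply, LinearMap.mulLeft_apply, AlgHom.toLinearMap_apply,
        Ideal.Quotient.mkₐ_eq_mk]
      rw [eq_comm, Ideal.Quotient.eq]
      exact J.mem_of_dvd (R.dvd_sub_ψ hv) hlJ
    · rintro _ ⟨v, hv, rfl⟩
      refine ⟨swap R.ξ ^ j * v, ?_, rfl⟩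
      simpa using mul_mem_forms (pow_mem_forms (swap_mem_forms R.ξ_mem) j) hv
  have h2 : part J m 0 = forms K m 0 ⊓ LinearMap.ker
      ((Ideal.Quotient.mkₐ K J).toLinearMap ∘ₗ LinearMap.mulLeft K (swap R.ξ ^ j)) := by
    ext p
    simp only [mem_part, Submodule.mem_inf, LinearMap.mem_ker, LinearMap.comp_apply,
      LinearMap.mulLeft_apply, AlgHom.toLinearMap_apply, Ideal.Quotient.mkₐ_eq_mk,
      Ideal.Quotient.eq_zero_iff_mem, R.mem_of_ξ_pow_mul_mem hJ hlJ, and_comm]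
  rw [← h1, ← h2] at h
  rw [← h, hilb, if_pos ⟨by positivity, by positivity⟩]
  rfl

end LineRetraction

theorem exists_finrank_part_of_hasDegree {l : S K} (hl : IsLine01 l) {J : Ideal (S K)}
    (hJ : sat J = J) (hlJ : l ∈ J) {q : ℕ} (hq : HasDegree J q)
    (M : ℕ) :
    ∃ m, M ≤ m ∧ q + finrank K (part J m 0) = m + 1 := by
  obtain ⟨R⟩ := hl.swap.exists_lineRetraction
  obtain ⟨N, hN⟩ := hq
  refine ⟨max M N.toNat, le_max_left _ _, ?_⟩
  rw [← R.hilb_add_finrank_part_zero hJ hlJ _ N.toNat, hN]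
  · exact (Int.self_le_toNat N).trans (by exact_mod_cast le_max_right _ _)
  · exact Int.self_le_toNat N

/-- For large `m` the multiples of `f` fill `m - i + 1` dimensions of `J_{m,0}`, which has dimension
only `m + 1 - q`. -/
theorem le_of_mem_forms_of_hasDegree {l : S K} (hl : IsLine01 l) {J : Ideal (S K)}
    (hJ : sat J = J) (hlJ : l ∈ J) {q : ℕ} (hq : HasDegree J q)
    {f : S K} {i : ℕ} (hf : f ∈ forms K i 0) (hfJ : f ∈ J)
    (hf0 : f ≠ 0) : q ≤ i := by
  obtain ⟨m, him, hm⟩ := exists_finrank_part_of_hasDegree hl hJ hlJ hq i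
  have h1 : (forms K (m - i) 0).map (LinearMap.mulLeft K f) ≤ part J m 0 := by
    rintro _ ⟨u, hu, rfl⟩
    refine ⟨J.mul_mem_right _ hfJ, ?_⟩
    have := mul_mem_forms hf hu
    rwa [Nat.add_sub_cancel' him] at this
  have h2 := Submodule.finrank_mono h1
  rw [finrank_map_mul_left hf0, finrank_forms_left] at h2
  omega

/-- Raising the x-degree by one adds at most one dimension to `J_{i,0}`, so dimension `m + 1 - q`
for large `m` forces `J_{q,0} ≠ 0`. A nonzero element restricting to zero on `ρ` would be `ρu` with
`u ∈ J` of x-degree `q - 1`, which is too small. -/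
theorem exists_form_of_hasDegree {l : S K} (hl : IsLine01 l) {J : Ideal (S K)}
    (hJ : sat J = J) (hlJ : l ∈ J) {q : ℕ} (hq : HasDegree J q)
    {ρ : S K} (hρ : IsLine10 ρ) (T : LineRetraction ρ)
    (hρJ : ∀ u, ρ * u ∈ J ↔ u ∈ J) : ∃ f ∈ J, f ∈ forms K q 0 ∧ T.φ f ≠ 0 := by
  have hstep : ∀ i k, finrank K (part J (i + k) 0) ≤ finrank K (part J i 0) + k := by
    intro i k
    induction k with
    | zero => simp
    | succ k ih =>
      rw [← add_assoc, T.finrank_part_succ hρ hρJ]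
      have := Submodule.finrank_mono (T.image_le_forms J (i + k + 1) 0)
      rw [finrank_forms_zero_zero] at this
      omega
  obtain ⟨m, hqm, hm⟩ := exists_finrank_part_of_hasDegree hl hJ hlJ hq q
  have h1 := hstep q (m - q)
  rw [Nat.add_sub_cancel' hqm] at h1
  have h2 : part J q 0 ≠ ⊥ := by
    intro h
    rw [h, finrank_bot] at h1
    omega
  obtain ⟨f, ⟨hfJ, hf⟩, hf0⟩ := Submodule.exists_mem_ne_zero_of_ne_bot h2
  refine ⟨f, hfJ, hf, fun h0 => ?_⟩
  cases q with
  | zero => exact hf0 ((T.φ_eq_self hf).symm.trans h0)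
  | succ q =>
    obtain ⟨u, rfl⟩ := (T.φ_eq_zero_iff hf).1 h0
    have hu : u ∈ forms K q 0 := by
      refine mul_cancel_mem_forms hρ.1 hρ.2 ?_
      rwa [add_comm 1 q, add_zero]
    have := le_of_mem_forms_of_hasDegree hl hJ hlJ hq hu ((hρJ u).1 hfJ)
      (right_ne_zero_of_mul hf0)
    omega

/-! ### Membership criteria for restrictions to a `(1,0)`-line -/

theorem dvd_of_dvd_mul_of_isRelPrime {M : Type*} [CommMonoidWithZero M] [IsCancelMulZero M]
    [DecompositionMonoid M] {a b c g : M} (hab : IsRelPrime a b) (ha : c ∣ a * g)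
    (hb : c ∣ b * g) : c ∣ g := by
  obtain ⟨c₁, c₂, h₁, ⟨g', rfl⟩, rfl⟩ := exists_dvd_and_dvd_of_dvd_mul ha
  rcases eq_or_ne c₂ 0 with rfl | h0
  · simp
  · rw [mul_comm c₁, mul_left_comm] at hb
    have h2 := (mul_dvd_mul_iff_left h0).1 hb
    rw [mul_comm c₁]
    exact mul_dvd_mul_left _ ((hab.of_dvd_left h₁).dvd_of_dvd_mul_left h2)

theorem isRelPrime_X_pow (N : ℕ) :
    IsRelPrime ((X (Sum.inr 0) : S K) ^ N) (X (Sum.inr 1) ^ N) := by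
  refine IsRelPrime.pow_left (IsRelPrime.pow_right ?_)
  rw [Irreducible.isRelPrime_iff_not_dvd X_prime.irreducible, X_dvd_X]
  simp

/-- Saturating creates nothing new on the line: `(ξ y_e)^N` restricts to `y_e^N`, and `y₀^N`, `y₁^N`
are coprime. -/
theorem LineRetraction.dvd_φ_of_mem_interIdeal {ρ : S K} (T : LineRetraction ρ) {c v : S K}
    {d : ℕ} (hc : c ∈ forms K 0 d) (hv : v ∈ interIdeal (Ideal.span {ρ}) (Ideal.span {c})) :
    c ∣ T.φ v := by
  obtain ⟨N, hN⟩ := hv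
  have hξ : ∀ e, T.ξ * X (Sum.inr e) ∈ irr K := by
    intro e
    obtain ⟨u, -, w, -, h⟩ := exists_eq_X_inl_add T.ξ_mem
    have : T.ξ * X (Sum.inr e) = u * (X (Sum.inl 0) * X (Sum.inr e)) +
        w * (X (Sum.inl 1) * X (Sum.inr e)) := by rw [h]; ring
    rw [this]
    exact Ideal.add_mem _ (Ideal.mul_mem_left _ _ (X_mul_X_mem_irr _ _))
      (Ideal.mul_mem_left _ _ (X_mul_X_mem_irr _ _))
  have key : ∀ e, c ∣ X (Sum.inr e) ^ N * T.φ v := by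
    intro e
    have h1 := hN _ (Ideal.pow_mem_pow (hξ e) N)
    rw [← Ideal.span_insert] at h1
    obtain ⟨a, b, hab⟩ := Ideal.mem_span_pair.1 h1
    have h2 := congrArg T.φ hab
    simp only [map_add, map_mul, map_pow, T.φ_ρ, T.φ_ξ, T.φ_X_inr, T.φ_eq_self hc, mul_zero,
      zero_add, one_mul] at h2
    exact ⟨T.φ b, by rw [← h2, mul_comm]⟩
  exact dvd_of_dvd_mul_of_isRelPrime (isRelPrime_X_pow N) (key 0) (key 1)

/-- Let `U` be the space of forms that `y₀` and `y₁` both multiply into the image in degree `d + 1`.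
It contains the image in degree `d`; if nonzero, it is strictly smaller in dimension than the image
in degree `d + 1`. Growth by one leaves no room between the two. -/
theorem LineRetraction.mem_image_of_X_mul_mem {ρ : S K} (T : LineRetraction ρ)
    {V : Ideal (S K)} {i d : ℕ}
    (h : finrank K (T.image V i (d + 1)) = finrank K (T.image V i d) + 1) {p : S K}
    (hp : p ∈ forms K 0 d) (hXp : ∀ e, X (Sum.inr e) * p ∈ T.image V i (d + 1)) :
    p ∈ T.image V i d := by
  let U : Submodule K (S K) := forms K 0 d ⊓
    ⨅ e, (T.image V i (d + 1)).comap (LinearMap.mulLeft K (X (Sum.inr e)))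
  have memU : ∀ u, u ∈ U ↔
      u ∈ forms K 0 d ∧ ∀ e, X (Sum.inr e) * u ∈ T.image V i (d + 1) := by
    intro u
    simp only [U, Submodule.mem_inf, Submodule.mem_iInf, Submodule.mem_comap,
      LinearMap.mulLeft_apply]
  have : Module.Finite K U :=
    Submodule.finiteDimensional_of_le (inf_le_left : U ≤ forms K 0 d)
  have hle : T.image V i d ≤ U := by
    intro g hg
    refine (memU g).2 ⟨T.image_le_forms _ _ _ hg, fun e => ?_⟩
    rw [add_comm d 1]
    exact T.mul_mem_image hg (X_inr_mem_forms e)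
  have hpU : p ∈ U := (memU p).2 ⟨hp, hXp⟩
  by_cases hU : U = ⊥
  · rw [hU, Submodule.mem_bot] at hpU
    rw [hpU]
    exact zero_mem _
  · have hlt := finrank_lt_of_X_mul_mem hU fun u hu => ((memU u).1 hu).2
    rw [Submodule.eq_of_le_of_finrank_le hle (by omega)]
    exact hpU

theorem exists_coeff_of_isLine01 {l : S K} (hl : IsLine01 l) :
    ∃ a b : K, l = C a * X (Sum.inr 0) + C b * X (Sum.inr 1) ∧ (a ≠ 0 ∨ b ≠ 0) := by
  obtain ⟨a, b, h, hab⟩ := exists_coeff_of_isLine10 hl.swap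
  refine ⟨a, b, ?_, hab⟩
  rw [← swap_swap l, h]
  simp

theorem sameCurve_C_mul {t : K} (ht : t ≠ 0) (l : S K) : SameCurve l (C t * l) := by
  rw [SameCurve, Ideal.span_singleton_mul_left_unit]
  exact (isUnit_iff_ne_zero.2 ht).map C

/-- The equations of two distinct `(0, 1)`-lines span the linear forms in `y₀, y₁`. -/
theorem X_mul_mem_of_not_sameCurve {l l' : S K} (hl : IsLine01 l) (hl' : IsLine01 l')
    (h : ¬SameCurve l l') {M : Submodule K (S K)} {p : S K} (hp : p * l ∈ M)
    (hp' : p * l' ∈ M) (e : Fin 2) : X (Sum.inr e) * p ∈ M := by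
  obtain ⟨a, b, rfl, hab⟩ := exists_coeff_of_isLine01 hl
  obtain ⟨a', b', rfl, hab'⟩ := exists_coeff_of_isLine01 hl'
  have hdet : a * b' - a' * b ≠ 0 := by
    intro h0
    refine h ?_
    obtain ⟨t, ht, rfl, rfl⟩ : ∃ t, t ≠ 0 ∧ a' = t * a ∧ b' = t * b := by
      rcases hab with ha | hb
      · have hb' : b' = a' / a * b := by field_simp; linear_combination h0
        refine ⟨a' / a, fun h1 => ?_, by field_simp, hb'⟩
        have : a' = 0 := by simpa [ha] using h1
        simp [this] at hb' hab'
        exact hab' hb'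
      · have ha' : a' = b' / b * a := by field_simp; linear_combination -h0
        refine ⟨b' / b, fun h1 => ?_, ha', by field_simp⟩
        have : b' = 0 := by simpa [hb] using h1
        simp [this] at ha' hab'
        exact hab' ha'
    have := sameCurve_C_mul ht (C a * X (Sum.inr 0) + C b * X (Sum.inr 1))
    convert this using 1
    simp only [C_mul]
    ring
  have hC : (C (a * b' - a' * b)⁻¹ * (C a * C b' - C a' * C b) : S K) = 1 := by
    rw [← C_mul, ← C_mul, ← C_sub, ← C_mul, inv_mul_cancel₀ hdet, C_1]
  fin_cases e
  · have := M.smul_mem (a * b' - a' * b)⁻¹ (M.sub_mem (M.smul_mem b' hp) (M.smul_mem b hp'))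
    simp only [smul_eq_C_mul] at this
    convert this using 1
    simp only [Fin.zero_eta]
    linear_combination -(X (Sum.inr 0) * p) * hC
  · have := M.smul_mem (a * b' - a' * b)⁻¹ (M.sub_mem (M.smul_mem a hp') (M.smul_mem a' hp))
    simp only [smul_eq_C_mul] at this
    convert this using 1
    simp only [Fin.mk_one]
    linear_combination -(X (Sum.inr 1) * p) * hC

/-! ### Products of lines with some indices omitted -/

open scoped Classical in
/-- The product of the forms `C 0, …, C n` whose indices are not in `E`. -/
def prodExcept (C : ℕ → S K) (n : ℕ) (E : Set ℕ) : S K :=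
  ∏ i ∈ (Finset.range (n + 1)).filter (fun i => i ∉ E), C i

section prodExcept

variable {C : ℕ → S K} {n : ℕ}

theorem prodExcept_ne_zero (hC : ∀ i ≤ n, IsLine01 (C i)) (E : Set ℕ) :
    prodExcept C n E ≠ 0 := by
  classical
  refine Finset.prod_ne_zero_iff.2 fun i hi => (hC i ?_).2
  simp only [Finset.mem_filter, Finset.mem_range] at hi
  omega

theorem prod_mem_forms {s : Finset ℕ} (hs : ∀ i ∈ s, IsLine01 (C i)) :
    ∏ i ∈ s, C i ∈ forms K 0 s.card := by
  classical
  induction s using Finset.induction_on with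
  | empty => simpa using one_mem_forms
  | insert a s ha ih =>
    rw [Finset.prod_insert ha, Finset.card_insert_of_notMem ha, add_comm]
    exact mul_mem_forms (hs a (by simp)).1 (ih fun i hi => hs i (by simp [hi]))

theorem prodExcept_mem_forms (hC : ∀ i ≤ n, IsLine01 (C i)) {idx : ℕ → ℕ} {B : Finset ℕ}
    (hinj : Set.InjOn idx B) (hB : ∀ k ∈ B, idx k ≤ n) :
    prodExcept C n (idx '' B) ∈ forms K 0 (n + 1 - B.card) := by
  classical
  have hcard : ((Finset.range (n + 1)).filter (fun i => i ∉ idx '' B)).card =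
      n + 1 - B.card := by
    have : (Finset.range (n + 1)).filter (fun i => i ∉ idx '' B) =
        Finset.range (n + 1) \ B.image idx := by
      ext i
      simp
    rw [this, Finset.card_sdiff_of_subset, Finset.card_image_of_injOn hinj, Finset.card_range]
    intro i hi
    obtain ⟨k, hk, rfl⟩ := Finset.mem_image.1 hi
    exact Finset.mem_range.2 (Nat.lt_succ_of_le (hB k hk))
  rw [← hcard]
  refine prod_mem_forms fun i hi => hC i ?_
  simp only [Finset.mem_filter, Finset.mem_range] at hi
  omega

theorem prodExcept_erase {idx : ℕ → ℕ} {B : Finset ℕ} (hinj : Set.InjOn idx B) {l : ℕ}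
    (hl : l ∈ B) (hln : idx l ≤ n) :
    prodExcept C n (idx '' (B.erase l : Finset ℕ)) =
      prodExcept C n (idx '' B) * C (idx l) := by
  classical
  rw [prodExcept, prodExcept]
  have : (Finset.range (n + 1)).filter (fun i => i ∉ idx '' (B.erase l : Finset ℕ)) =
      insert (idx l) ((Finset.range (n + 1)).filter (fun i => i ∉ idx '' B)) := by
    ext i
    simp only [Finset.mem_filter, Finset.mem_range, Finset.mem_insert, Set.mem_image,
      Finset.mem_coe, Finset.mem_erase, not_exists, not_and]
    constructor
    · rintro ⟨h1, h2⟩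
      by_cases hi : i = idx l
      · exact Or.inl hi
      · refine Or.inr ⟨h1, fun k hk hki => h2 k ⟨?_, hk⟩ hki⟩
        rintro rfl
        exact hi hki.symm
    · rintro (rfl | ⟨h1, h2⟩)
      · exact ⟨by omega, fun k hk hkl => hk.1 (hinj hk.2 hl hkl)⟩
      · exact ⟨h1, fun k hk => h2 k hk.2⟩
  rw [this, Finset.prod_insert, mul_comm]
  simp only [Finset.mem_filter, not_and, not_not]
  exact fun _ => ⟨l, hl, rfl⟩

theorem not_dvd_prodExcept (hC : ∀ i ≤ n, IsLine01 (C i)) {E : Set ℕ} {m : ℕ} (hm : m ∈ E)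
    (hmn : m ≤ n) (hsimple : ∀ i ≤ n, i ≠ m → ¬SameCurve (C i) (C m)) :
    ¬C m ∣ prodExcept C n E := by
  classical
  intro h
  obtain ⟨i, hi, hdvd⟩ := (hC m hmn).prime.exists_mem_finset_dvd h
  simp only [Finset.mem_filter, Finset.mem_range] at hi
  have hin : i ≤ n := by omega
  refine hsimple i hin (fun h => hi.2 (h ▸ hm)) ?_
  exact Ideal.span_singleton_eq_span_singleton.2
    ((hC m hmn).prime.irreducible.associated_of_dvd (hC i hin).prime.irreducible hdvd).symm

/-- Each restored line is prime and differs from all other listed lines, hence does not divide the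
product reached so far and must divide the cofactor. -/
theorem prodExcept_dvd (hC : ∀ i ≤ n, IsLine01 (C i)) {idx : ℕ → ℕ} {A : Finset ℕ}
    (hinj : Set.InjOn idx A) (hidx : ∀ k ∈ A, idx k ≤ n)
    (hsimple : ∀ k ∈ A, ∀ i ≤ n, i ≠ idx k → ¬SameCurve (C i) (C (idx k)))
    {g : S K} (hg : prodExcept C n (idx '' A) ∣ g) {D : Finset ℕ} (hDA : D ⊆ A)
    (hD : ∀ k ∈ D, C (idx k) ∣ g) :
    prodExcept C n (idx '' (A \ D : Finset ℕ)) ∣ g := by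
  classical
  induction D using Finset.induction_on with
  | empty => simpa using hg
  | insert k D hk ih =>
    have hkA : k ∈ A := hDA (Finset.mem_insert_self _ _)
    have hkD : k ∈ A \ D := Finset.mem_sdiff.2 ⟨hkA, hk⟩
    obtain ⟨u, rfl⟩ := ih ((Finset.subset_insert _ _).trans hDA)
      fun m hm => hD m (Finset.mem_insert_of_mem hm)
    have hnd := not_dvd_prodExcept (n := n) hC (E := idx '' (A \ D : Finset ℕ))
      ⟨k, by exact_mod_cast hkD, rfl⟩ (hidx k hkA) (hsimple k hkA)
    have hu := ((hC _ (hidx k hkA)).prime.dvd_mul.1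
      (hD k (Finset.mem_insert_self _ _))).resolve_left hnd
    have : A \ insert k D = (A \ D).erase k := by
      ext m
      simp only [Finset.mem_sdiff, Finset.mem_insert, Finset.mem_erase]
      tauto
    rw [this, prodExcept_erase (hinj.mono (by simp)) hkD (hidx k hkA)]
    exact mul_dvd_mul_left _ hu

/-- Induction on the number of omitted lines. Arbitrary subsets `B` of `{1, …, k}` are needed, since
the step removes either of two elements of `B`. -/
theorem prodExcept_mem_image {ρ : S K} (T : LineRetraction ρ) {I : Ideal (S K)}
    (hC : ∀ i ≤ n, IsLine01 (C i)) {r : ℕ} {idx q : ℕ → ℕ}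
    (hidx : ∀ k ∈ Set.Icc 1 r, idx k ≤ n) (hinj : Set.InjOn idx (Set.Icc 1 r))
    (hsimple : ∀ k ∈ Set.Icc 1 r, ∀ i ≤ n, i ≠ idx k → ¬SameCurve (C i) (C (idx k)))
    (hrn : r ≤ n + 1) (hqmono : MonotoneOn q (Set.Icc 1 r))
    (hbase : ∀ k ∈ Set.Icc 1 r,
      prodExcept C n (idx '' ({k} : Finset ℕ)) ∈ T.image I (q k) n)
    (hstep : ∀ k ∈ Set.Icc 2 r, ∀ i, q k ≤ i →
      finrank K (T.image I i (n + 1 - k + 1)) = finrank K (T.image I i (n + 1 - k)) + 1)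
    {k : ℕ} (hk : k ∈ Set.Icc 1 r) {B : Finset ℕ} (hB : B ⊆ Finset.Icc 1 k)
    (hne : B.Nonempty) :
    prodExcept C n (idx '' B) ∈ T.image I (q k) (n + 1 - B.card) := by
  classical
  have hB' : ∀ {B : Finset ℕ}, B ⊆ Finset.Icc 1 k → (B : Set ℕ) ⊆ Set.Icc 1 r := by
    intro B hB m hm
    have := Finset.mem_Icc.1 (hB hm)
    exact ⟨this.1, this.2.trans hk.2⟩
  obtain ⟨m, hm⟩ : ∃ m, B.card = m + 1 := Nat.exists_eq_succ_of_ne_zero hne.card_ne_zero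
  induction m generalizing B with
  | zero =>
    obtain ⟨l, rfl⟩ := Finset.card_eq_one.1 hm
    have hl : l ∈ Finset.Icc 1 k := hB (by simp)
    have hlr : l ∈ Set.Icc 1 r := hB' hB (by simp)
    rw [hm]
    exact T.image_mono I (hqmono hlr hk (Finset.mem_Icc.1 hl).2) n (hbase l hlr)
  | succ m ih =>
    obtain ⟨l, hl, l', hl', hll'⟩ := Finset.one_lt_card.1 (by omega : 1 < B.card)
    have hcard : B.card ≤ k := by simpa using Finset.card_le_card hB
    have hkr : k ≤ r := hk.2
    have hidxB : ∀ j ∈ B, idx j ≤ n := fun j hj => hidx j (hB' hB hj)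
    have hinjB : Set.InjOn idx B := hinj.mono (hB' hB)
    have herase : ∀ j ∈ B, prodExcept C n (idx '' B) * C (idx j) ∈
        T.image I (q k) (n + 1 - B.card + 1) := by
      intro j hj
      have h1 := Finset.card_erase_of_mem hj
      rw [← prodExcept_erase hinjB hj (hidxB j hj)]
      have := ih ((Finset.erase_subset _ _).trans hB)
        (Finset.card_pos.1 (by rw [h1]; omega)) (by rw [h1]; omega)
      rwa [show n + 1 - (B.erase j).card = n + 1 - B.card + 1 by omega] at this
    -- The growth condition is used at index `B.card`, not `k`; it applies in x-degree `q k` because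
    -- `B.card ≤ k` and `q` is monotone.
    refine T.mem_image_of_X_mul_mem (hstep B.card ⟨by omega, by omega⟩ _ ?_)
      (prodExcept_mem_forms hC hinjB hidxB) ?_
    · exact hqmono (a := B.card) ⟨by omega, by omega⟩ hk hcard
    · refine X_mul_mem_of_not_sameCurve (hC _ (hidxB l hl)) (hC _ (hidxB l' hl')) ?_
        (herase l hl) (herase l' hl')
      exact hsimple l' (hB' hB hl') _ (hidxB l hl) fun h => hll' (hinjB hl hl' h)

end prodExcept

/-! ### The Hilbert function of the union -/

/-- As `I` is its own residual, `ΔM = 0` means that the image grows by exactly one dimension. -/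
theorem LineRetraction.deltaHilb_eq {ρ : S K} (T : LineRetraction ρ) (hρ : IsLine10 ρ)
    {I : Ideal (S K)} (h : ∀ u, ρ * u ∈ I ↔ u ∈ I) (i d : ℕ) :
    deltaHilb I i ((d : ℤ) + 1) =
      1 - finrank K (T.image I i (d + 1)) + finrank K (T.image I i d) := by
  have h1 := T.hilb_eq hρ h i (d + 1)
  have h2 := T.hilb_eq hρ h i d
  push_cast at h1 h2
  rw [deltaHilb, add_sub_cancel_right, h1, h2]
  ring

theorem card_filter_le_iff {q : ℕ → ℕ} {r : ℕ} (hq : MonotoneOn q (Set.Icc 1 r)) {k : ℕ}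
    (hk : k ∈ Set.Icc 1 r) (i : ℕ) :
    q k ≤ i ↔ k ≤ ((Finset.Icc 1 r).filter (fun m => q m ≤ i)).card := by
  constructor
  · intro h
    have : Finset.Icc 1 k ⊆ (Finset.Icc 1 r).filter (fun m => q m ≤ i) := by
      intro m hm
      rw [Finset.mem_Icc] at hm
      have hmr : m ∈ Set.Icc 1 r := ⟨hm.1, hm.2.trans hk.2⟩
      exact Finset.mem_filter.2 ⟨Finset.mem_Icc.2 hmr, (hq hmr hk hm.2).trans h⟩
    simpa using Finset.card_le_card this
  · contrapose!
    intro h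
    have : (Finset.Icc 1 r).filter (fun m => q m ≤ i) ⊆ Finset.Icc 1 (k - 1) := by
      intro m hm
      rw [Finset.mem_filter, Finset.mem_Icc] at hm
      rw [Finset.mem_Icc]
      refine ⟨hm.1.1, ?_⟩
      by_contra! hkm
      have := hq hk ⟨hm.1.1, hm.1.2⟩ (by omega)
      omega
    have h1 := Finset.card_le_card this
    rw [Nat.card_Icc] at h1
    have := hk.1
    omega

theorem mul_mem_residual_iff {I P : Ideal (S K)} {ρ : S K} (hρ : ρ ∈ P)
    (h : ∀ u, ρ * u ∈ I ↔ u ∈ I) (u : S K) : ρ * u ∈ I ⊓ P ↔ u ∈ I := by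
  rw [Ideal.mem_inf, h]
  exact and_iff_left (P.mul_mem_right u hρ)

/-- The image of the ideal of `X ∪ 𝒫` consists of the multiples of `c` in the image of the ideal
of `X`. -/
theorem LineRetraction.mem_image_inf {ρ : S K} (T : LineRetraction ρ) {I : Ideal (S K)} {c : S K}
    {d : ℕ} (hc : c ∈ forms K 0 d) {i j : ℕ} {g : S K} :
    g ∈ T.image (I ⊓ interIdeal (Ideal.span {ρ}) (Ideal.span {c})) i j ↔
      g ∈ T.image I i j ∧ c ∣ g := by
  rw [T.mem_image, T.mem_image]
  constructor
  · rintro ⟨v, hv, hv', rfl⟩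
    exact ⟨⟨v, hv.1, hv', rfl⟩, T.dvd_φ_of_mem_interIdeal hc hv.2⟩
  · rintro ⟨⟨v, hv, hv', rfl⟩, hcv⟩
    refine ⟨v, ⟨hv, le_sat _ ?_⟩, hv', rfl⟩
    rw [← sub_add_cancel v (T.ξ ^ i * T.φ v)]
    exact Ideal.add_mem _
      (Ideal.mem_sup_left (Ideal.mem_span_singleton.2 (T.dvd_sub hv')))
      (Ideal.mem_sup_right (Ideal.mem_span_singleton.2 (hcv.mul_left _)))

/-- The image of the ideal in degrees less than the number of points on a `(0, 1)`-line is
contained in the ideal of the line. -/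
theorem LineRetraction.dvd_of_mem_image {ρ : S K} (T : LineRetraction ρ) {I : Ideal (S K)}
    {l : S K} (hl : IsLine01 l) {q : ℕ} (hq : NumPointsOn I l q) {i j : ℕ} (hi : i < q) {g : S K}
    (hg : g ∈ T.image I i j) : l ∣ g := by
  obtain ⟨R⟩ := hl.swap.exists_lineRetraction
  obtain ⟨v, hv, hv', rfl⟩ := T.mem_image.1 hg
  refine R.dvd_of_ψ_eq_zero (T.φ_mem hv') ?_
  -- The restriction of `v` to `l` has x-degree `i < q`, too small to vanish at `q` points without
  -- being zero.
  have hψ : R.ψ v = 0 := by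
    by_contra h0
    have := le_of_mem_forms_of_hasDegree hl (sat_sat _) (mem_interIdeal_right I l) hq
      (R.ψ_mem hv') (R.ψ_mem_ideal (sat_sat _) (mem_interIdeal_right I l) hv'
        (le_interIdeal_left _ _ hv)) h0
    omega
  rw [R.ψ_comm, hψ, map_zero]

theorem C_mul_mem_iff {a : K} (ha : a ≠ 0) {V : Submodule K (S K)} {p : S K} :
    C a * p ∈ V ↔ p ∈ V := by
  rw [← smul_eq_C_mul]
  exact V.smul_mem_iff ha

/-- A form `f` of bidegree `(q,0)` through the points on `l` is a nonzero constant on `ρ = 0`; then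
`f * p ∈ I` restricts to a nonzero multiple of `p`. -/
theorem LineRetraction.mem_image_of_mul_mem {ρ : S K} (hρ : IsLine10 ρ) (T : LineRetraction ρ)
    {I : Ideal (S K)} (hI : sat I = I) (hρI : NumPointsOn I ρ 0) {l : S K} (hl : IsLine01 l)
    {q : ℕ} (hq : NumPointsOn I l q) {p : S K} {d : ℕ} (hp : p ∈ forms K 0 d)
    (hpl : p * l ∈ I) : p ∈ T.image I q d := by
  obtain ⟨f, hfJ, hf, hf0⟩ := exists_form_of_hasDegree hl (sat_sat _) (mem_interIdeal_right I l)
    hq hρ T (mul_mem_iff_of_numPointsOn_zero hρI (le_interIdeal_left _ _) (sat_sat _))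
  obtain ⟨a, ha⟩ := exists_C_of_mem_forms_zero (T.φ_mem hf)
  have ha0 : a ≠ 0 := by
    rintro rfl
    exact hf0 (by simp [ha])
  rw [← C_mul_mem_iff ha0]
  refine T.mem_image.2 ⟨f * p, mul_mem_of_mem_interIdeal hI hpl hfJ, ?_, ?_⟩
  · simpa using mul_mem_forms hf hp
  · rw [map_mul, ha, T.φ_eq_self hp]

/-- If `C m` contained no point, the other `b` lines would already contain the scheme, against the
minimality of `b + 1`. -/
theorem pos_of_numPointsOn {ρ : S K} (hρ : IsLine10 ρ) {I : Ideal (S K)} (hI : sat I = I)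
    (hρI : NumPointsOn I ρ 0) {b : ℕ} (hb : b + 1 ∈ lowerBounds {j : ℕ | ∃ f ∈ I,
      f ∈ forms K 0 j ∧ f ≠ 0}) {C : ℕ → S K} (hC : ∀ i ≤ b, IsLine01 (C i))
    (hCI : ∏ i ∈ Finset.range (b + 1), C i ∈ I) {m : ℕ} (hm : m ≤ b) {q : ℕ}
    (hq : NumPointsOn I (C m) q) : 1 ≤ q := by
  classical
  obtain ⟨T⟩ := hρ.exists_lineRetraction
  by_contra! h0
  obtain rfl : q = 0 := by omega
  have hmem : m ∈ Finset.range (b + 1) := Finset.mem_range.2 (by omega)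
  have hC' : ∀ i ∈ (Finset.range (b + 1)).erase m, IsLine01 (C i) := by
    intro i hi
    rw [Finset.mem_erase, Finset.mem_range] at hi
    exact hC i (by omega)
  have hp := prod_mem_forms hC'
  rw [Finset.card_erase_of_mem hmem, Finset.card_range, Nat.add_sub_cancel] at hp
  have h1 := T.mem_image_of_mul_mem hρ hI hρI (hC m hm) hq hp
    (by rwa [Finset.prod_erase_mul _ _ hmem])
  rw [T.image_zero_left] at h1
  have := hb ⟨_, h1.1, h1.2, Finset.prod_ne_zero_iff.2 fun i hi => (hC' i hi).2⟩
  omega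

/-- The Hilbert function of the union of a zero-dimensional scheme with points on a
`(1, 0)`-line. -/
theorem hilb_inf_pointsIdeal {I : Ideal (S K)} (hI : sat I = I) {n : ℕ} {C : ℕ → S K}
    (hC : ∀ i ≤ n, IsLine01 (C i)) (hCI : ∏ i ∈ Finset.range (n + 1), C i ∈ I)
    {ρ : S K} (hρ : IsLine10 ρ) (hρI : NumPointsOn I ρ 0) {r : ℕ} {idx q : ℕ → ℕ}
    (hidx : ∀ k ∈ Set.Icc 1 r, idx k ≤ n) (hinj : Set.InjOn idx (Set.Icc 1 r))
    (hsimple : ∀ k ∈ Set.Icc 1 r, ∀ i ≤ n, i ≠ idx k → ¬SameCurve (C i) (C (idx k)))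
    (hrn : r ≤ n + 1) (hq : ∀ k ∈ Set.Icc 1 r, NumPointsOn I (C (idx k)) (q k))
    (hqmono : MonotoneOn q (Set.Icc 1 r))
    (hcond : ∀ k ∈ Set.Icc 2 r, ∀ i : ℕ, q k ≤ i → deltaHilb I i ((n : ℤ) - k + 2) = 0)
    (i j : ℕ) :
    (hilb (I ⊓ pointsIdeal ρ C n (idx '' Set.Icc 1 r)) i j : ℤ) = hilb I ((i : ℤ) - 1) j +
      min (j + 1) (n + 1 - ((Finset.Icc 1 r).filter (fun k => q k ≤ i)).card : ℕ) := by
  classical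
  obtain ⟨T⟩ := hρ.exists_lineRetraction
  have hρI' := mul_mem_iff_of_numPointsOn_zero hρI le_rfl hI
  have hIcc : (Set.Icc 1 r : Set ℕ) = (Finset.Icc 1 r : Finset ℕ) := by simp
  set B := (Finset.Icc 1 r).filter (fun k => q k ≤ i) with hBdef
  have hBr : (B : Set ℕ) ⊆ Set.Icc 1 r := by
    rw [hIcc]
    exact_mod_cast Finset.filter_subset _ _
  have hBforms := prodExcept_mem_forms hC (hinj.mono hBr) (fun k hk => hidx k (hBr hk))
  have hnone : prodExcept C n (idx '' (∅ : Finset ℕ)) ∈ I := by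
    simpa [prodExcept] using hCI
  have hbase : ∀ k ∈ Set.Icc 1 r,
      prodExcept C n (idx '' ({k} : Finset ℕ)) ∈ T.image I (q k) n := by
    intro k hk
    have h1 := prodExcept_mem_forms hC (idx := idx) (B := {k}) (by simp)
      (by simpa using hidx k hk)
    refine T.mem_image_of_mul_mem hρ hI hρI (hC _ (hidx k hk)) (hq k hk) (by simpa using h1) ?_
    rw [← prodExcept_erase (by simp) (Finset.mem_singleton_self k) (hidx k hk)]
    simpa using hnone
  have hstep : ∀ k ∈ Set.Icc 2 r, ∀ i, q k ≤ i →
      finrank K (T.image I i (n + 1 - k + 1)) = finrank K (T.image I i (n + 1 - k)) + 1 := by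
    intro k hk i hi
    have h1 := hcond k hk i hi
    have hkr : k ≤ r := hk.2
    rw [show (n : ℤ) - k + 2 = ((n + 1 - k : ℕ) : ℤ) + 1 by omega,
      T.deltaHilb_eq hρ hρI'] at h1
    omega
  have himage : prodExcept C n (idx '' B) ∈ T.image I i (n + 1 - B.card) := by
    rcases B.eq_empty_or_nonempty with hB | hB
    · rw [hB] at hBforms ⊢
      refine T.image_mono I (Nat.zero_le i) _ ?_
      rw [T.image_zero_left]
      exact ⟨hnone, hBforms⟩
    · have hmax := Finset.max'_mem B hB
      refine T.image_mono I (Finset.mem_filter.1 hmax).2 _ (prodExcept_mem_image T hC hidx hinj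
        hsimple hrn hqmono hbase hstep (hBr hmax) (fun k hk => ?_) hB)
      exact Finset.mem_Icc.2 ⟨(hBr hk).1, Finset.le_max' B k hk⟩
  have hcforms := prodExcept_mem_forms hC (idx := idx) (B := Finset.Icc 1 r)
    (by simpa using hinj) (by simpa using hidx)
  have hW : pointsIdeal ρ C n (idx '' Set.Icc 1 r) = interIdeal (Ideal.span {ρ})
      (Ideal.span {prodExcept C n (idx '' (Finset.Icc 1 r : Finset ℕ))}) := by
    rw [← hIcc]
    rfl
  -- The lines with `q k > i` are forced back into the product; those with `q k ≤ i`, indexed by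
  -- `B`, stay omitted.
  have hpart : T.image (I ⊓ pointsIdeal ρ C n (idx '' Set.Icc 1 r)) i j =
      part (Ideal.span {prodExcept C n (idx '' B)}) 0 j := by
    ext g
    rw [hW, T.mem_image_inf hcforms, mem_part, Ideal.mem_span_singleton]
    constructor
    · rintro ⟨hg, hcg⟩
      refine ⟨?_, T.image_le_forms _ _ _ hg⟩
      have h1 := prodExcept_dvd hC (by simpa using hinj) (by simpa using hidx)
        (by simpa using hsimple) hcg (Finset.filter_subset (fun k => ¬q k ≤ i) _) ?_
      · rwa [← Finset.filter_not, Finset.filter_congr (q := fun k => q k ≤ i)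
          (by simp)] at h1
      · intro k hk
        rw [Finset.mem_filter, Finset.mem_Icc] at hk
        exact T.dvd_of_mem_image (hC _ (hidx k hk.1)) (hq k hk.1) (not_le.1 hk.2) hg
    · rintro ⟨⟨u, rfl⟩, hu⟩
      refine ⟨?_, Dvd.dvd.mul_right ?_ u⟩
      · have hP := prodExcept_ne_zero hC (idx '' B)
        rcases lt_or_ge j (n + 1 - B.card) with hlt | hle
        · rw [eq_zero_of_dvd_of_lt hBforms hu hlt (dvd_mul_right _ _)]
          exact zero_mem _
        · obtain ⟨e, rfl⟩ := Nat.exists_eq_add_of_le hle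
          rw [mul_comm, add_comm _ e]
          refine T.mul_mem_image himage (mul_cancel_mem_forms hBforms hP ?_)
          simpa using hu
      · refine Finset.prod_dvd_prod_of_subset _ _ _ fun m hm => ?_
        rw [Finset.mem_filter] at hm ⊢
        refine ⟨hm.1, fun h => hm.2 (Set.image_mono ?_ h)⟩
        exact_mod_cast Finset.filter_subset _ _
  have hmain := T.hilb_eq hρ (mul_mem_residual_iff (P := pointsIdeal ρ C n (idx '' Set.Icc 1 r))
    (le_sat _ (Ideal.mem_sup_left (Ideal.mem_span_singleton_self ρ))) hρI') i j
  -- The truncated subtraction in `finrank_part_span` produces the minimum.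
  rw [hmain, hpart, finrank_part_span hBforms (prodExcept_ne_zero hC _)]
  omega

end BiProj

end

/-! ### First differences -/

theorem mainTheorem6 {K : Type*} [Field K] [IsAlgClosed K]
    (X : BiProj.ZeroDimScheme K) (a b : ℕ) (hsize : BiProj.HasSize X.ideal a b)
    -- the `(0,1)`-lines `C 0, …, C b` containing `X`, and arbitrary ones `C (b+1), …, C n`
    (n : ℕ) (hbn : b ≤ n) (C : ℕ → BiProj.S K) (hC : ∀ i ≤ n, BiProj.IsLine01 (C i))
    (hCX : ∏ i ∈ Finset.range (b + 1), C i ∈ X.ideal)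
    -- a `(1,0)`-line disjoint from `X`
    (ρ : BiProj.S K) (hρ : BiProj.IsLine10 ρ) (hρX : BiProj.NumPointsOn X.ideal ρ 0)
    -- the indices `i_1, …, i_r`; the lines with these indices occur only once in the list
    (r : ℕ) (idx : ℕ → ℕ) (hidx : ∀ k ∈ Set.Icc 1 r, idx k ≤ b)
    (hinj : Set.InjOn idx (Set.Icc 1 r))
    (hsimple : ∀ k ∈ Set.Icc 1 r, ∀ i ≤ n, i ≠ idx k →
      ¬ BiProj.SameCurve (C i) (C (idx k)))
    (q : ℕ → ℕ) (hq : ∀ k ∈ Set.Icc 1 r, BiProj.NumPointsOn X.ideal (C (idx k)) (q k))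
    (hqmono : MonotoneOn q (Set.Icc 1 r))
    (hcond : r = 1 ∨ ∀ k ∈ Set.Icc 2 r, ∀ i : ℕ, q k ≤ i →
      BiProj.deltaHilb X.ideal i ((n : ℤ) - k + 2) = 0)
    (W : Ideal (BiProj.S K))
    (hW : W = X.ideal ⊓ BiProj.pointsIdeal ρ C n (idx '' Set.Icc 1 r))
    (T : Set (ℤ × ℤ)) (hT : T = {p | ∃ k ∈ Set.Icc 1 r, p = ((q k : ℤ), (n : ℤ) - k + 1)}) :
    (∀ j : ℕ, j ≤ n → BiProj.deltaHilb W 0 j = 1) ∧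
    (∀ j : ℕ, n + 1 ≤ j → BiProj.deltaHilb W 0 j = 0) ∧
    (∀ i j : ℕ, 1 ≤ i → ((i : ℤ), (j : ℤ)) ∉ T →
      BiProj.deltaHilb W i j = BiProj.deltaHilb X.ideal ((i : ℤ) - 1) j) ∧
    (∀ i j : ℕ, 1 ≤ i → ((i : ℤ), (j : ℤ)) ∈ T →
      BiProj.deltaHilb W i j = BiProj.deltaHilb X.ideal ((i : ℤ) - 1) j - 1) := by
  classical
  subst hW hT
  have hI := X.saturated
  have hidxn : ∀ k ∈ Set.Icc 1 r, idx k ≤ n := fun k hk => (hidx k hk).trans hbn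
  have hCI : ∏ i ∈ Finset.range (n + 1), C i ∈ X.ideal :=
    X.ideal.mem_of_dvd (Finset.prod_dvd_prod_of_subset _ _ _
      (Finset.range_mono (by omega))) hCX
  have hrb : r ≤ b + 1 := by
    have h := Finset.card_le_card_of_injOn (s := Finset.Icc 1 r) (t := Finset.range (b + 1)) idx
      (fun k hk => Finset.mem_coe.2 (Finset.mem_range.2
        (Nat.lt_succ_of_le (hidx k (by simpa using hk))))) (by simpa using hinj)
    simpa using h
  have hcond' : ∀ k ∈ Set.Icc 2 r, ∀ i : ℕ, q k ≤ i →
      BiProj.deltaHilb X.ideal i ((n : ℤ) - k + 2) = 0 := by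
    rcases hcond with rfl | h
    · rintro k ⟨h1, h2⟩
      omega
    · exact h
  have hqpos : ∀ k ∈ Set.Icc 1 r, 1 ≤ q k := fun k hk =>
    BiProj.pos_of_numPointsOn hρ hI hρX hsize.2.2 (fun i hi => hC i (hi.trans hbn)) hCX
      (hidx k hk) (hq k hk)
  have hmain := BiProj.hilb_inf_pointsIdeal hI hC hCI hρ hρX hidxn hinj hsimple (by omega) hq
    hqmono hcond'
  obtain ⟨N, hN⟩ : ∃ N : ℕ → ℕ, ∀ i, N i =
    ((Finset.Icc 1 r).filter (fun k => q k ≤ i)).card := ⟨_, fun _ => rfl⟩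
  simp only [← hN] at hmain
  set W := X.ideal ⊓ BiProj.pointsIdeal ρ C n (idx '' Set.Icc 1 r)
  have hNiff : ∀ k ∈ Set.Icc 1 r, ∀ i, q k ≤ i ↔ k ≤ N i := fun k hk i =>
    hN i ▸ BiProj.card_filter_le_iff hqmono hk i
  have hNr : ∀ i, N i ≤ r := fun i => by
    simpa [hN] using Finset.card_filter_le (Finset.Icc 1 r) (fun k => q k ≤ i)
  -- Positivity of the `q k` makes the row `i = 0` equal to `min (j + 1) (n + 1)`.
  have hN0 : N 0 = 0 := by
    rw [hN, Finset.card_eq_zero, Finset.filter_eq_empty_iff]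
    intro k hk
    have := hqpos k (by simpa using hk)
    omega
  have hneg : ∀ (I : Ideal (BiProj.S K)) (i : ℤ), BiProj.hilb I i (((0 : ℕ) : ℤ) - 1) = 0 :=
    fun I i => BiProj.hilb_of_neg_right I (by simp)
  have hneg' : ∀ (I : Ideal (BiProj.S K)) (j : ℤ), BiProj.hilb I (((0 : ℕ) : ℤ) - 1) j = 0 :=
    fun I j => BiProj.hilb_of_neg_left I (by simp)
  have hzero : ∀ j : ℕ, BiProj.deltaHilb W 0 j = if j ≤ n then 1 else 0 := by
    intro j
    have h1 := hmain 0 j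
    rw [hneg', hN0] at h1
    have h2 := hneg' W j
    simp only [Nat.cast_zero] at h1 h2
    rw [BiProj.deltaHilb, h1, h2]
    cases j with
    | zero => simp [BiProj.hilb_of_neg_right]
    | succ j =>
      have h3 := hmain 0 j
      have h4 := hneg' W j
      rw [hneg', hN0] at h3
      simp only [Nat.cast_zero] at h3 h4
      rw [show ((j + 1 : ℕ) : ℤ) - 1 = j by simp, h3, h4]
      split_ifs <;> push_cast <;> omega
  have hsucc : ∀ i j : ℕ, BiProj.deltaHilb W ((i + 1 : ℕ) : ℤ) j =
      BiProj.deltaHilb X.ideal i j +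
        ((if j + N (i + 1) ≤ n then 1 else 0) - if j + N i ≤ n then 1 else 0) := by
    intro i j
    have h1 := hmain (i + 1) j
    have h2 := hmain i j
    have hr1 := hNr i
    have hr2 := hNr (i + 1)
    have hi : ((i + 1 : ℕ) : ℤ) - 1 = i := by simp
    rw [hi] at h1
    rw [BiProj.deltaHilb, BiProj.deltaHilb, hi, h1, h2]
    cases j with
    | zero =>
      simp only [hneg]
      split_ifs <;> push_cast <;> omega
    | succ j =>
      have h3 := hmain (i + 1) j
      have h4 := hmain i j
      rw [hi] at h3
      rw [show ((j + 1 : ℕ) : ℤ) - 1 = j by simp, h3, h4]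
      split_ifs <;> push_cast <;> omega
  have hNmono : ∀ i, N i ≤ N (i + 1) := by
    intro i
    rw [hN, hN]
    exact Finset.card_le_card (Finset.monotone_filter_right _ fun k _ hk => Nat.le_succ_of_le hk)
  -- The correction `-1` occurs when `k = n + 1 - j` satisfies `N i < k ≤ N (i + 1)`, which by
  -- monotonicity of `q` means `q k = i + 1`.
  have hTiff : ∀ i j : ℕ,
      (∃ k ∈ Set.Icc 1 r, (((i + 1 : ℕ) : ℤ), (j : ℤ)) = ((q k : ℤ), (n : ℤ) - k + 1)) ↔
        j + N i ≤ n ∧ n < j + N (i + 1) := by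
    intro i j
    have hr2 := hNr (i + 1)
    constructor
    · rintro ⟨k, hk, h⟩
      simp only [Prod.mk.injEq] at h
      have h1 := hNiff k hk i
      have h2 := hNiff k hk (i + 1)
      omega
    · rintro ⟨h1, h2⟩
      have hk : n + 1 - j ∈ Set.Icc 1 r := ⟨by omega, by omega⟩
      have h3 := hNiff _ hk i
      have h4 := hNiff _ hk (i + 1)
      refine ⟨n + 1 - j, hk, ?_⟩
      simp only [Prod.mk.injEq]
      omega
  refine ⟨fun j hj => by rw [hzero, if_pos hj], fun j hj => by rw [hzero, if_neg (by omega)],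
    fun i j hi hT => ?_, fun i j hi hT => ?_⟩
  · obtain ⟨i, rfl⟩ := Nat.exists_eq_add_of_le' hi
    have h1 := mt (hTiff i j).2 hT
    have h2 := hNmono i
    rw [hsucc, show ((i + 1 : ℕ) : ℤ) - 1 = i by simp]
    split_ifs <;> omega
  · obtain ⟨i, rfl⟩ := Nat.exists_eq_add_of_le' hi
    have h1 := (hTiff i j).1 hT
    rw [hsucc, show ((i + 1 : ℕ) : ℤ) - 1 = i by simp, if_pos h1.1, if_neg (by omega)]
    ring
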